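/- Let $0\le b<1$ and let $Z=(Z(t))_{t\ge 0}$ be the time-homogeneous Markov process on $(0,\infty)$ with càdlàg paths, started from $Z(0)=1$, with infinitesimal generator $$\mathcal G f(x)=-bx f'(x)+x\bigl(f(x+1)-f(x)\bigr).$$ Precisely, on a probability space $(\Omega,\mathcal F,\mathbb P)$ with a filtration $(\mathcal F_t)_{t\ge0}$, $Z$ is adapted, has càdlàg paths in $(0,\infty)$ and $Z(0)=1$ a.s., and for every $C^\infty$ function $f$ with compact support in $(0,\infty)$ the process $f(Z(t))-\int_0^t\mathcal G f(Z(s))\,\mathrm ds$ is an $(\mathcal F_t)$-martingale. Set $$W_t=e^{-(1-b)t}Z(t),\qquad B(t)=Z(t)+b\int_0^t Z(s)\,\mathrm ds,\qquad W^*=\sup_{t\ge0}W_t .$$ Then: 1. $W$ is an $(\mathcal F_t)$-martingale, and for every real $k\ge1$ it is bounded in $L^k(\mathbb P)$, i.e. $\sup_{t\ge0}\mathbb E(W_t^k)<\infty$. 2. $W$ has a terminal value $W_\infty\in L^1(\mathbb P)$, i.e. $W_t\to W_\infty$ a.s. as $t\to\infty$ and $W_t=\mathbb E(W_\infty\mid\mathcal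 F_t)$ a.s. for every $t\ge0$, and $$\lim_{t\to\infty}e^{-(1-b)t}B(t)=\frac{1}{1-b}\,W_\infty\qquad\text{a.s.}$$ 3. Almost surely $W^*<\infty$ and $$\sup_{t\ge0}e^{-(1-b)t}B(t)\le\frac1{1-b}\,W^*,$$ and $\frac{1}{1-b}W^*\in L^k(\mathbb P)$ for every real $k\ge1$. -/

import Mathlib

open MeasureTheory ProbabilityTheory Set Filter Topology
open scoped NNReal ENNReal

namespace CSBP

/-- A path indexed by `[0, ∞)` is càdlàg in the state space `S ⊆ ℝ`: it stays in `S`, is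
right-continuous, and has left limits that belong to `S`. -/
structure IsCadlagIn (S : Set ℝ) (x : ℝ≥0 → ℝ) : Prop where
  mem : ∀ t, x t ∈ S
  right_cont : ∀ t, ContinuousWithinAt x (Ici t) t
  left_lim : ∀ t, 0 < t → ∃ l ∈ S, Tendsto x (𝓝[<] t) (𝓝 l)

/-- The operator `𝒢 f(x) = -b x f'(x) + x (f(x+1) - f(x))`. -/
noncomputable def generator (b : ℝ) (f : ℝ → ℝ) (x : ℝ) : ℝ :=
  -b * x * deriv f x + x * (f (x + 1) - f x)

/-- `Z` is, with respect to the filtration `ℱ` and the probability `P`, the process on `(0, ∞)`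
with infinitesimal generator `generator b` started from `1`. This is the (well-posed) martingale
problem for the generator: `Z` is adapted with càdlàg paths in `(0, ∞)`, `Z 0 = 1` almost surely,
and `f (Z t) - ∫₀ᵗ 𝒢 f (Z s) ds` is a martingale for every smooth `f` with compact support
in `(0, ∞)`. -/
structure IsProcess {Ω : Type*} {mΩ : MeasurableSpace Ω} (b : ℝ) (ℱ : Filtration ℝ≥0 mΩ)
    (P : Measure Ω) (Z : ℝ≥0 → Ω → ℝ) : Prop where
  adapted : StronglyAdapted ℱ Z
  cadlag : ∀ ω, IsCadlagIn (Ioi 0) (fun t => Z t ω)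
  init : ∀ᵐ ω ∂P, Z 0 ω = 1
  martingale : ∀ f : ℝ → ℝ, ContDiff ℝ (⊤ : ℕ∞) f → HasCompactSupport f → tsupport f ⊆ Ioi 0 →
    Martingale
      (fun (t : ℝ≥0) ω => f (Z t ω) - ∫ s in (0 : ℝ)..t, generator b f (Z s.toNNReal ω)) ℱ P

/-- `W t = exp (-(1 - b) t) * Z t`. -/
noncomputable def W {Ω : Type*} (b : ℝ) (Z : ℝ≥0 → Ω → ℝ) (t : ℝ≥0) (ω : Ω) : ℝ :=
  Real.exp (-(1 - b) * t) * Z t ω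

/-- `B t = Z t + b * ∫₀ᵗ Z s ds`. -/
noncomputable def B {Ω : Type*} (b : ℝ) (Z : ℝ≥0 → Ω → ℝ) (t : ℝ≥0) (ω : Ω) : ℝ :=
  Z t ω + b * ∫ s in (0 : ℝ)..t, Z s.toNNReal ω

/-- The overall supremum `W* = sup_{t ≥ 0} W t`, meaningful where the path of `W` is bounded. -/
noncomputable def Wstar {Ω : Type*} (b : ℝ) (Z : ℝ≥0 → Ω → ℝ) (ω : Ω) : ℝ :=
  ⨆ t : ℝ≥0, W b Z t ω

end CSBP

/-!
The argument rests on Dynkin's formula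
`E[f (Z t); A] = E[f (Z s); A] + ∫ₛᵗ E[𝒢 f (Z r); A] dr` for `A ∈ ℱ s`. For test functions it is the
martingale problem integrated over `A`. It extends, by dominated convergence along smooth cutoffs,
to every smooth `f` such that `f` and `𝒢 f` are `O((1 + x) ^ k)`, provided the `k`-th moment of `Z`
is locally bounded in time (`IsProcess.dynkin_of_hasGrowth`). The cutoffs vary only on multiplicative
scales, so that the errors `x χ' f` and `x f(x + 1) (χ(x + 1) - χ(x))` do not exceed the growth of
`f`. No stopping times are needed.

Moments. The bounded functions `f_ε = ((1 + x) / (1 + ε x)) ^ k` satisfy `𝒢 f_ε ≤ c f_ε` with `c`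
independent of `ε`. Gronwall's inequality and Fatou's lemma then make all moments of `Z` finite
(`IsProcess.locBddMoment`), and Dynkin's formula becomes available for polynomials. For `f x = x`
one has `𝒢 f = (1 - b) f`, which says that `W` is a martingale. From
`𝒢 (1 + x) ^ k ≤ k (1 - b) (1 + x) ^ k + D (1 + x) ^ (k - 1)` and induction on `k`, the `k`-th moment
of `Z` is `O(exp (k (1 - b) t))`, which says that `W` is bounded in `L^k`.

Supremum and limit. Doob's maximal inequality passes from dyadic grids to the real time axis by
right-continuity (`measure_exists_lt_abs_le`). With the moment bounds it gives `Wstar` a tail smaller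
than every power, hence moments of all orders. As `Wstar` is integrable, the almost sure limit of `W`
along the integers closes the martingale, and the maximal inequality for the increments of `W`
after time `n` upgrades the convergence to one along the reals (`ae_tendsto_of_tendsto_nat`).

The statements about `B` are then pathwise: with `a = 1 - b`,
`exp (-a t) B t = W t + b ∫₀ᵗ exp (-a (t - s)) W s ds`, where the exponential weight has total mass
at most `1 / a` and asymptotically equal to it, and `1 + b / a = 1 / a`.
-/

namespace CSBP

/-! ### Smooth cutoffs -/

lemma deriv_smoothTransition_eq_zero {u : ℝ} (hu : u < 0 ∨ 1 < u) :
    deriv Real.smoothTransition u = 0 := by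
  rcases hu with hu | hu
  · have : Real.smoothTransition =ᶠ[𝓝 u] fun _ => (0 : ℝ) := by
      filter_upwards [Iio_mem_nhds hu] with y hy
      exact Real.smoothTransition.zero_of_nonpos (le_of_lt hy)
    simpa using this.deriv_eq
  · have : Real.smoothTransition =ᶠ[𝓝 u] fun _ => (1 : ℝ) := by
      filter_upwards [Ioi_mem_nhds hu] with y hy
      exact Real.smoothTransition.one_of_one_le (le_of_lt hy)
    simpa using this.deriv_eq

lemma exists_bound_deriv_smoothTransition :
    ∃ D : ℝ, 0 ≤ D ∧ ∀ u, |deriv Real.smoothTransition u| ≤ D := by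
  have hc : Continuous (deriv Real.smoothTransition) :=
    (Real.smoothTransition.contDiff (n := 1)).continuous_deriv le_rfl
  obtain ⟨C, hC⟩ := (isCompact_Icc (a := (0 : ℝ)) (b := 1)).exists_bound_of_continuousOn
    hc.continuousOn
  refine ⟨C, (abs_nonneg _).trans (hC 0 (by simp)), fun u => ?_⟩
  by_cases hu : u ∈ Icc (0 : ℝ) 1
  · exact hC u hu
  · rw [deriv_smoothTransition_eq_zero (by simp only [mem_Icc, not_and_or, not_le] at hu; exact hu)]
    simpa using (abs_nonneg _).trans (hC 0 (by simp))

/-- There are smooth cutoffs with compact support in `(0, ∞)`, eventually equal to `1` near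
each point of `(0, ∞)`, along which the operator `x ↦ x χ'(x)` and the weighted difference
`x (χ (x + 1) - χ x)` stay bounded: a cutoff that varies only on the scales `x ≈ 1 / n` and
`x ≈ n` has both properties by scaling. -/
lemma exists_cutoff : ∃ (χ : ℕ → ℝ → ℝ) (D : ℝ), 0 ≤ D ∧ ∀ n,
    ContDiff ℝ (⊤ : ℕ∞) (χ n) ∧ HasCompactSupport (χ n) ∧ tsupport (χ n) ⊆ Ioi 0 ∧
    (∀ x, |χ n x| ≤ 1) ∧ (∀ x, |x * deriv (χ n) x| ≤ D) ∧
    (∀ x, 0 < x → |x * (χ n (x + 1) - χ n x)| ≤ D) ∧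
    (∀ x ∈ Ioo (2 / (n + 1) : ℝ) (n + 1), χ n x = 1) := by
  obtain ⟨D, hD0, hD⟩ := exists_bound_deriv_smoothTransition
  have h1 : ∀ u, |u * deriv Real.smoothTransition (u - 1)| ≤ 2 * D := by
    intro u
    by_cases hu : u - 1 < 0 ∨ 1 < u - 1
    · rw [deriv_smoothTransition_eq_zero hu]; simpa using hD0
    · push Not at hu
      rw [abs_mul]
      exact mul_le_mul (abs_le.2 ⟨by linarith, by linarith⟩) (hD _) (abs_nonneg _) (by norm_num)
  have h2 : ∀ u, |u * deriv Real.smoothTransition (2 - u)| ≤ 2 * D := by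
    intro u
    by_cases hu : 2 - u < 0 ∨ 1 < 2 - u
    · rw [deriv_smoothTransition_eq_zero hu]; simpa using hD0
    · push Not at hu
      rw [abs_mul]
      exact mul_le_mul (abs_le.2 ⟨by linarith, by linarith⟩) (hD _) (abs_nonneg _) (by norm_num)
  have hS : ∀ u, |Real.smoothTransition u| ≤ 1 := fun u => by
    rw [abs_of_nonneg (Real.smoothTransition.nonneg u)]; exact Real.smoothTransition.le_one u
  refine ⟨fun n x => Real.smoothTransition ((n + 1) * x - 1) *
    Real.smoothTransition (2 - x / (n + 1)), 4 * D, by positivity, fun n => ?_⟩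
  set N : ℝ := n + 1 with hN
  have hNpos : 0 < N := by positivity
  have hsupp : tsupport (fun x => Real.smoothTransition (N * x - 1) *
      Real.smoothTransition (2 - x / N)) ⊆ Icc (1 / N) (2 * N) := by
    refine closure_minimal (fun x hx => ?_) isClosed_Icc
    rw [Function.mem_support] at hx
    constructor
    · by_contra hlt
      push Not at hlt
      rw [lt_div_iff₀ hNpos] at hlt
      exact hx (by rw [Real.smoothTransition.zero_of_nonpos (by linarith), zero_mul])
    · by_contra hlt
      push Not at hlt
      rw [← lt_div_iff₀ hNpos] at hlt
      exact hx (by rw [Real.smoothTransition.zero_of_nonpos (x := 2 - x / N) (by linarith),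
        mul_zero])
  have hder : ∀ x, HasDerivAt (fun x => Real.smoothTransition (N * x - 1) *
      Real.smoothTransition (2 - x / N))
      (deriv Real.smoothTransition (N * x - 1) * N * Real.smoothTransition (2 - x / N) +
        Real.smoothTransition (N * x - 1) * (deriv Real.smoothTransition (2 - x / N) *
          (-(1 / N)))) x := by
    intro x
    have hd : Differentiable ℝ Real.smoothTransition :=
      (Real.smoothTransition.contDiff (n := 1)).differentiable one_ne_zero
    refine HasDerivAt.mul (HasDerivAt.comp x (hd _).hasDerivAt ?_)
      (HasDerivAt.comp x (hd _).hasDerivAt ?_)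
    · simpa using ((hasDerivAt_id x).const_mul N).sub_const 1
    · simpa using ((hasDerivAt_id x).div_const N).const_sub 2
  have hxd : ∀ x, |x * deriv (fun x => Real.smoothTransition (N * x - 1) *
      Real.smoothTransition (2 - x / N)) x| ≤ 4 * D := by
    intro x
    rw [(hder x).deriv]
    have e : x * (deriv Real.smoothTransition (N * x - 1) * N * Real.smoothTransition (2 - x / N) +
        Real.smoothTransition (N * x - 1) * (deriv Real.smoothTransition (2 - x / N) *
          (-(1 / N)))) =
        (N * x) * deriv Real.smoothTransition (N * x - 1) * Real.smoothTransition (2 - x / N) -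
        (x / N) * deriv Real.smoothTransition (2 - x / N) *
          Real.smoothTransition (N * x - 1) := by
      ring
    rw [e]
    refine (abs_sub _ _).trans ?_
    rw [abs_mul (N * x * _), abs_mul (x / N * _)]
    have a1 := mul_le_mul (h1 (N * x)) (hS (2 - x / N)) (abs_nonneg _) (by positivity)
    have a2 := mul_le_mul (h2 (x / N)) (hS (N * x - 1)) (abs_nonneg _) (by positivity)
    linarith
  have hcd : ContDiff ℝ (⊤ : ℕ∞) (fun x => Real.smoothTransition (N * x - 1) *
      Real.smoothTransition (2 - x / N)) := by
    refine ContDiff.mul (Real.smoothTransition.contDiff.comp ?_)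
      (Real.smoothTransition.contDiff.comp ?_)
    · fun_prop
    · fun_prop
  refine ⟨hcd, ?_, ?_, ?_, hxd, ?_, ?_⟩
  · exact isCompact_Icc.of_isClosed_subset (isClosed_tsupport _) hsupp
  · exact hsupp.trans fun x hx => lt_of_lt_of_le (by positivity) hx.1
  · intro x
    rw [abs_mul]
    exact mul_le_one₀ (hS _) (abs_nonneg _) (hS _)
  · intro x hx
    obtain ⟨ξ, hξ, hξe⟩ := exists_hasDerivAt_eq_slope _ _ (show x < x + 1 by linarith)
      hcd.continuous.continuousOn (fun y _ => (hcd.differentiable (by simp) y).hasDerivAt)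
    rw [add_sub_cancel_left, div_one] at hξe
    rw [← hξe, abs_mul, abs_of_pos hx]
    refine le_trans ?_ (hxd ξ)
    rw [abs_mul]
    exact mul_le_mul_of_nonneg_right (hξ.1.le.trans (le_abs_self _)) (abs_nonneg _)
  · intro x hx
    have b1 : 2 < x * N := by rw [← div_lt_iff₀ hNpos]; exact hx.1
    have b2 : x / N < 1 := by rw [div_lt_one hNpos]; exact hx.2
    simp only
    rw [Real.smoothTransition.one_of_one_le (by linarith),
      Real.smoothTransition.one_of_one_le (by linarith), one_mul]

lemma generator_mul (b : ℝ) {f χ : ℝ → ℝ} {x : ℝ} (hf : DifferentiableAt ℝ f x)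
    (hχ : DifferentiableAt ℝ χ x) :
    generator b (fun y => f y * χ y) x = χ x * generator b f x - b * f x * (x * deriv χ x) +
      f (x + 1) * (x * (χ (x + 1) - χ x)) := by
  simp only [generator]
  rw [deriv_fun_mul hf hχ]
  ring

/-! ### Bounds for the generator -/

/-- The expansion `(y + 1) ^ (k + 1) = y ^ (k + 1) + (k + 1) y ^ k + O(y ^ (k - 1))` on `[1, ∞)`,
multiplied by `y`. -/
lemma exists_mul_add_one_pow_le (k : ℕ) : ∃ D : ℝ, 0 ≤ D ∧ ∀ y : ℝ, 1 ≤ y →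
    y * (y + 1) ^ (k + 1) ≤ y ^ (k + 2) + (k + 1) * y ^ (k + 1) + D * y ^ k := by
  induction k with
  | zero => exact ⟨0, le_rfl, fun y _ => by norm_num; nlinarith⟩
  | succ k ih =>
    obtain ⟨D, hD, h⟩ := ih
    refine ⟨k + 1 + 2 * D, by positivity, fun y hy => ?_⟩
    have h1 := mul_le_mul_of_nonneg_right (h y hy) (show 0 ≤ y + 1 by linarith)
    have h2 : D * y ^ k ≤ D * y ^ (k + 1) :=
      mul_le_mul_of_nonneg_left (pow_le_pow_right₀ hy (by omega)) hD
    push_cast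
    calc y * (y + 1) ^ (k + 1 + 1) = y * (y + 1) ^ (k + 1) * (y + 1) := by ring
      _ ≤ _ := h1
      _ = y ^ (k + 1 + 2) + (k + 1 + 1) * y ^ (k + 1 + 1) + (k + 1 + D) * y ^ (k + 1) +
          D * y ^ k := by ring
      _ ≤ _ := by linarith

lemma generator_one_add_pow (b : ℝ) (k : ℕ) (x : ℝ) :
    generator b (fun x => (1 + x) ^ (k + 1)) x =
      -b * x * ((k + 1) * (1 + x) ^ k) + x * ((1 + x + 1) ^ (k + 1) - (1 + x) ^ (k + 1)) := by
  have : HasDerivAt (fun x : ℝ => (1 + x) ^ (k + 1)) ((k + 1) * (1 + x) ^ k) x := by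
    simpa using ((hasDerivAt_id x).const_add 1).fun_pow (k + 1)
  simp only [generator, this.deriv]
  ring_nf

/-- The drift of `(1 + x) ^ (k + 1)` is `(k + 1) (1 - b) (1 + x) ^ (k + 1)` up to lower order. -/
lemma exists_generator_one_add_pow_le {b : ℝ} (hb0 : 0 ≤ b) (k : ℕ) :
    ∃ D : ℝ, 0 ≤ D ∧ ∀ x : ℝ, 0 < x → generator b (fun x => (1 + x) ^ (k + 1)) x ≤
      (k + 1) * (1 - b) * (1 + x) ^ (k + 1) + D * (1 + x) ^ k := by
  obtain ⟨D, hD, h⟩ := exists_mul_add_one_pow_le k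
  refine ⟨b * (k + 1) + D, by positivity, fun x hx => ?_⟩
  rw [generator_one_add_pow]
  have h1 := h (1 + x) (by linarith)
  have h2 : (1 + x) ^ (k + 1) ≤ (1 + x + 1) ^ (k + 1) :=
    pow_le_pow_left₀ (by linarith) (by linarith) _
  have e : x = (1 + x) - 1 := by ring
  calc _ = -b * ((k + 1) * (1 + x) ^ (k + 1)) + b * ((k + 1) * (1 + x) ^ k) +
        ((1 + x) * (1 + x + 1) ^ (k + 1) - (1 + x) ^ (k + 2)) -
        ((1 + x + 1) ^ (k + 1) - (1 + x) ^ (k + 1)) := by ring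
    _ ≤ -b * ((k + 1) * (1 + x) ^ (k + 1)) + b * ((k + 1) * (1 + x) ^ k) +
        ((k + 1) * (1 + x) ^ (k + 1) + D * (1 + x) ^ k) := by linarith
    _ = _ := by ring

lemma exists_abs_generator_one_add_pow_le {b : ℝ} (hb0 : 0 ≤ b) (k : ℕ) :
    ∃ C : ℝ, 0 ≤ C ∧ ∀ x : ℝ, 0 < x → |generator b (fun x => (1 + x) ^ (k + 1)) x| ≤
      C * (1 + x) ^ (k + 1) := by
  obtain ⟨D, hD, h⟩ := exists_generator_one_add_pow_le hb0 k
  refine ⟨(k + 1) * (1 + b) + D, by positivity, fun x hx => abs_le.2 ⟨?_, ?_⟩⟩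
  · rw [generator_one_add_pow]
    have h2 : 0 ≤ x * ((1 + x + 1) ^ (k + 1) - (1 + x) ^ (k + 1)) :=
      mul_nonneg hx.le (sub_nonneg.2 (pow_le_pow_left₀ (by linarith) (by linarith) _))
    have h3 : x * (1 + x) ^ k ≤ (1 + x) ^ (k + 1) := by
      rw [pow_succ']; exact mul_le_mul_of_nonneg_right (by linarith) (by positivity)
    have h4 := mul_le_mul_of_nonneg_left h3 (show 0 ≤ b * (k + 1) by positivity)
    have h5 : 0 ≤ (k + 1 + D) * (1 + x) ^ (k + 1) := by positivity
    linarith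
  · have h1 : D * (1 + x) ^ k ≤ D * (1 + x) ^ (k + 1) :=
      mul_le_mul_of_nonneg_left (pow_le_pow_right₀ (by linarith) (by omega)) hD
    have h2 : 0 ≤ 2 * b * (k + 1) * (1 + x) ^ (k + 1) := by positivity
    linarith [h x hx]

/-- The bounded Lyapunov function `((1 + x) / (1 + ε x)) ^ k`, which increases to `(1 + x) ^ k` as
`ε` decreases to `0`. -/
noncomputable def lyap (ε : ℝ) (k : ℕ) (x : ℝ) : ℝ := ((1 + x) / (1 + ε * x)) ^ k

lemma lyap_nonneg {ε : ℝ} (hε : 0 ≤ ε) (k : ℕ) {x : ℝ} (hx : 0 < x) : 0 ≤ lyap ε k x := by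
  unfold lyap; positivity

lemma lyap_le {ε : ℝ} (hε : 0 < ε) (hε1 : ε ≤ 1) (k : ℕ) {x : ℝ} (hx : 0 < x) :
    lyap ε k x ≤ (1 / ε) ^ k := by
  refine pow_le_pow_left₀ (by positivity) ?_ k
  rw [div_le_div_iff₀ (by positivity) hε]
  nlinarith

lemma generator_lyap_bounds {b ε : ℝ} (hb0 : 0 ≤ b) (hε : 0 < ε) (hε1 : ε ≤ 1) (k : ℕ) {x : ℝ}
    (hx : 0 < x) :
    generator b (lyap ε (k + 1)) x ≤ (k + 1) * 2 ^ k * lyap ε (k + 1) x ∧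
      -(b * (k + 1) * lyap ε (k + 1) x) ≤ generator b (lyap ε (k + 1)) x := by
  have hq : 0 < 1 + ε * x := by positivity
  set g : ℝ → ℝ := fun x => (1 + x) / (1 + ε * x) with hg
  have hgx : 0 < g x := by simp only [hg]; positivity
  have hder : HasDerivAt g ((1 - ε) / (1 + ε * x) ^ 2) x := by
    have h1 : HasDerivAt (fun x : ℝ => 1 + x) 1 x := by simpa using (hasDerivAt_id x).const_add 1
    have h2 : HasDerivAt (fun x : ℝ => 1 + ε * x) ε x := by
      simpa using ((hasDerivAt_id x).const_mul ε).const_add 1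
    exact (h1.div h2 hq.ne').congr_deriv (by ring)
  have hderk : deriv (lyap ε (k + 1)) x = (k + 1) * g x ^ k * ((1 - ε) / (1 + ε * x) ^ 2) := by
    have := (hder.fun_pow (k + 1)).deriv
    simp only [Nat.add_sub_cancel, Nat.cast_add, Nat.cast_one] at this
    exact this
  have hd0 : 0 ≤ (1 - ε) / (1 + ε * x) ^ 2 := div_nonneg (by linarith) (by positivity)
  -- `x g' ≤ g`
  have hxd : x * ((1 - ε) / (1 + ε * x) ^ 2) ≤ g x := by
    simp only [hg]
    rw [← mul_div_assoc, div_le_div_iff₀ (by positivity) hq]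
    have : x * (1 - ε) ≤ (1 + x) * (1 + ε * x) := by nlinarith [mul_pos hε hx]
    nlinarith
  have hinc : g (x + 1) - g x = (1 - ε) / ((1 + ε * x) * (1 + ε * (x + 1))) := by
    have : 0 < 1 + ε * (x + 1) := by positivity
    simp only [hg]
    field_simp
    ring
  have hinc0 : 0 ≤ g (x + 1) - g x := by
    rw [hinc]; exact div_nonneg (by linarith) (by positivity)
  have hxinc : x * (g (x + 1) - g x) ≤ g x := by
    have : 0 < 1 + ε * (x + 1) := by positivity
    rw [hinc]
    simp only [hg]
    rw [← mul_div_assoc, div_le_div_iff₀ (by positivity) hq]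
    have : x * (1 - ε) ≤ (1 + x) * (1 + ε * (x + 1)) := by
      nlinarith [mul_pos hε hx, mul_pos hε (mul_pos hx hx)]
    nlinarith
  have h2g : g (x + 1) ≤ 2 * g x := by
    have : 0 < 1 + ε * (x + 1) := by positivity
    simp only [hg]
    rw [← mul_div_assoc, div_le_div_iff₀ this hq]
    nlinarith [mul_pos hε hx, mul_pos hε (mul_pos hx hx)]
  have hpow0 : 0 ≤ g (x + 1) ^ (k + 1) - g x ^ (k + 1) :=
    sub_nonneg.2 (pow_le_pow_left₀ hgx.le (by linarith) _)
  have hpow : g (x + 1) ^ (k + 1) - g x ^ (k + 1) ≤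
      (k + 1) * (2 ^ k * g x ^ k) * (g (x + 1) - g x) := by
    have hm : ∀ i ∈ Finset.range (k + 1),
        g (x + 1) ^ i * g x ^ (k + 1 - 1 - i) ≤ 2 ^ k * g x ^ k := by
      intro i hi
      have hi' : i ≤ k := by simpa [Nat.lt_succ_iff] using hi
      calc g (x + 1) ^ i * g x ^ (k + 1 - 1 - i) ≤ (2 * g x) ^ i * g x ^ (k - i) := by
            simp only [Nat.add_sub_cancel]
            gcongr
        _ = 2 ^ i * g x ^ k := by
            rw [mul_pow, mul_assoc, ← pow_add, Nat.add_sub_cancel' hi']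
        _ ≤ 2 ^ k * g x ^ k := by
            gcongr
            norm_num
    rw [← Commute.geom_sum₂_mul (Commute.all _ _)]
    refine mul_le_mul_of_nonneg_right ((Finset.sum_le_card_nsmul _ _ _ hm).trans_eq ?_) hinc0
    simp
  have hgk : 0 ≤ g x ^ k := by positivity
  have e1 : generator b (lyap ε (k + 1)) x =
      -b * ((k + 1) * g x ^ k * (x * ((1 - ε) / (1 + ε * x) ^ 2))) +
        x * (g (x + 1) ^ (k + 1) - g x ^ (k + 1)) := by
    simp only [generator, hderk]
    simp only [lyap, hg]
    ring
  have e2 : lyap ε (k + 1) x = g x ^ k * g x := pow_succ _ _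
  rw [e1, e2]
  constructor
  · have a1 : 0 ≤ b * ((k + 1) * g x ^ k * (x * ((1 - ε) / (1 + ε * x) ^ 2))) := by positivity
    have a2 : x * (g (x + 1) ^ (k + 1) - g x ^ (k + 1)) ≤
        (k + 1) * 2 ^ k * (g x ^ k * g x) := by
      calc _ ≤ x * ((k + 1) * (2 ^ k * g x ^ k) * (g (x + 1) - g x)) :=
            mul_le_mul_of_nonneg_left hpow hx.le
        _ = (k + 1) * (2 ^ k * g x ^ k) * (x * (g (x + 1) - g x)) := by ring
        _ ≤ (k + 1) * (2 ^ k * g x ^ k) * g x :=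
            mul_le_mul_of_nonneg_left hxinc (by positivity)
        _ = _ := by ring
    linarith
  · have a1 : b * ((k + 1) * g x ^ k * (x * ((1 - ε) / (1 + ε * x) ^ 2))) ≤
        b * ((k + 1) * g x ^ k * g x) := by gcongr
    have a2 := mul_nonneg hx.le hpow0
    linarith

/-! ### The integrating factor -/

/-- If `u` is an indefinite integral of `v`, then `exp (-c (r - s)) u r` is an indefinite integral
of `exp (-c (r - s)) (v r - c u r)`. -/
lemma exp_mul_eq_add_integral {u v : ℝ → ℝ} {s t : ℝ} (c : ℝ) (hst : s ≤ t)
    (hv : IntervalIntegrable v volume s t) (hu : ∀ r ∈ Icc s t, u r = u s + ∫ x in s..r, v x) :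
    Real.exp (-c * (t - s)) * u t =
      u s + ∫ r in s..t, Real.exp (-c * (r - s)) * (v r - c * u r) := by
  set U : ℝ → ℝ := fun r => u s + ∫ x in s..r, v x with hU
  have hUac : AbsolutelyContinuousOnInterval U s t :=
    ((LipschitzOnWith.absolutelyContinuousOnInterval (K := 0)
      (LipschitzWith.const _).lipschitzOnWith).add
      (hv.absolutelyContinuousOnInterval_intervalIntegral left_mem_uIcc))
  have hEc : ∀ x, HasDerivAt (fun r => Real.exp (-c * (r - s)))
      (-c * Real.exp (-c * (x - s))) x := by
    intro x
    have : HasDerivAt (fun r => -c * (r - s)) (-c) x := by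
      simpa using ((hasDerivAt_id x).sub_const s).const_mul (-c)
    simpa [mul_comm] using this.exp
  have hEac : AbsolutelyContinuousOnInterval (fun r => Real.exp (-c * (r - s))) s t :=
    ContDiffOn.absolutelyContinuousOnInterval (by fun_prop)
  have key := hEac.integral_deriv_mul_eq_sub hUac
  have e1 : U t = u t := (hu t ⟨hst, le_rfl⟩).symm
  have e2 : U s = u s := by simp [hU]
  rw [e1, e2] at key
  simp only [sub_self, mul_zero, Real.exp_zero, one_mul] at key
  rw [← sub_eq_iff_eq_add', ← key]
  refine intervalIntegral.integral_congr_ae ?_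
  filter_upwards [hv.ae_hasDerivAt_integral] with x hx hxI
  have hx' := (hx (uIoc_subset_uIcc hxI) s left_mem_uIcc).const_add (u s)
  have hxU : U x = u x := by
    refine (hu x ?_).symm
    rw [uIoc_of_le hst] at hxI
    exact ⟨hxI.1.le, hxI.2⟩
  rw [(hEc x).deriv, hx'.deriv, hxU]
  ring

/-! ### Right-continuous processes and dyadic times -/

/-- The first dyadic number of level `n` strictly above `t`. -/
noncomputable def dyadicAbove (n : ℕ) (t : ℝ≥0) : ℝ≥0 := (⌊t * 2 ^ n⌋₊ + 1 : ℕ) / 2 ^ n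

lemma lt_dyadicAbove (n : ℕ) (t : ℝ≥0) : t < dyadicAbove n t := by
  rw [dyadicAbove, lt_div_iff₀ (by positivity)]
  exact_mod_cast Nat.lt_floor_add_one (t * 2 ^ n)

lemma dyadicAbove_le (n : ℕ) (t : ℝ≥0) : dyadicAbove n t ≤ t + (1 / 2) ^ n := by
  rw [dyadicAbove, div_le_iff₀ (by positivity), add_mul, ← mul_pow]
  norm_num
  exact Nat.floor_le zero_le

lemma tendsto_dyadicAbove (t : ℝ≥0) :
    Tendsto (fun n => dyadicAbove n t) atTop (𝓝[≥] t) := by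
  refine tendsto_nhdsWithin_iff.2 ⟨?_, Eventually.of_forall fun n => (lt_dyadicAbove n t).le⟩
  refine tendsto_of_tendsto_of_tendsto_of_le_of_le tendsto_const_nhds ?_
    (fun n => (lt_dyadicAbove n t).le) (fun n => dyadicAbove_le n t)
  have : Tendsto (fun n : ℕ => ((1 / 2 : ℝ≥0)) ^ n) atTop (𝓝 0) :=
    NNReal.tendsto_pow_atTop_nhds_zero_of_lt_one (by
      rw [div_lt_one (by norm_num)]; norm_num)
  simpa using this.const_add t

/-- A right-continuous process is jointly measurable, as the pointwise limit of its dyadic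
discretizations from the right. -/
lemma measurable_uncurry_of_right_cont {Ω : Type*} {mΩ : MeasurableSpace Ω} {X : ℝ≥0 → Ω → ℝ}
    (hX : ∀ t, Measurable (X t)) (hrc : ∀ ω t, ContinuousWithinAt (fun t => X t ω) (Ici t) t) :
    Measurable (fun p : ℝ × Ω => X p.1.toNNReal p.2) := by
  refine measurable_of_tendsto_metrizable
    (f := fun n (p : ℝ × Ω) => X (dyadicAbove n p.1.toNNReal) p.2) (fun n => ?_) ?_
  · have h1 : Measurable (fun q : ℕ × Ω => X ((q.1 + 1 : ℕ) / 2 ^ n) q.2) :=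
      measurable_from_prod_countable_right fun k => hX ((k + 1 : ℕ) / 2 ^ n)
    have h2 : Measurable (fun p : ℝ × Ω => (⌊p.1.toNNReal * 2 ^ n⌋₊, p.2)) :=
      (Nat.measurable_floor.comp
        ((measurable_real_toNNReal.comp measurable_fst).mul_const _)).prodMk measurable_snd
    exact h1.comp h2
  · rw [tendsto_pi_nhds]
    exact fun p => (hrc p.2 _).tendsto.comp (tendsto_dyadicAbove _)

/-! ### Dynkin's formula -/

section Dynkin

variable {Ω : Type*} {mΩ : MeasurableSpace Ω} {b : ℝ} {ℱ : Filtration ℝ≥0 mΩ}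
    {P : Measure Ω} {Z : ℝ≥0 → Ω → ℝ}

lemma measurable_generator (b : ℝ) {f : ℝ → ℝ} (hf : Measurable f) :
    Measurable (generator b f) := by
  unfold generator
  have := measurable_deriv f
  fun_prop

lemma IsProcess.pos (hZ : IsProcess b ℱ P Z) (t : ℝ≥0) (ω : Ω) : 0 < Z t ω :=
  (hZ.cadlag ω).mem t

lemma IsProcess.measurable (hZ : IsProcess b ℱ P Z) (t : ℝ≥0) : Measurable (Z t) :=
  (hZ.adapted.stronglyMeasurable (i := t)).measurable

lemma IsProcess.measurable_uncurry (hZ : IsProcess b ℱ P Z) :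
    Measurable (fun p : ℝ × Ω => Z p.1.toNNReal p.2) :=
  measurable_uncurry_of_right_cont hZ.measurable fun ω => (hZ.cadlag ω).right_cont

/-- Dynkin's formula on the events of the past: the integrated form of the statement that
`f (Z t) - ∫₀ᵗ 𝒢 f (Z s) ds` is a martingale. -/
def Dynkin (b : ℝ) (ℱ : Filtration ℝ≥0 mΩ) (P : Measure Ω) (Z : ℝ≥0 → Ω → ℝ) (f : ℝ → ℝ) : Prop :=
  ∀ s t : ℝ≥0, s ≤ t → ∀ A, MeasurableSet[ℱ s] A →
    ∫ ω in A, f (Z t ω) ∂P = ∫ ω in A, f (Z s ω) ∂P +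
      ∫ r in (s : ℝ)..t, ∫ ω in A, generator b f (Z r.toNNReal ω) ∂P

lemma exists_bound_generator (b : ℝ) {f : ℝ → ℝ} (hf : ContDiff ℝ (⊤ : ℕ∞) f)
    (hc : HasCompactSupport f) : ∃ C, ∀ x, ‖generator b f x‖ ≤ C := by
  have h1 : Continuous (deriv f) := hf.continuous_deriv (by simp)
  have h2 : HasCompactSupport (fun x => f (x + 1)) := hc.comp_homeomorph (Homeomorph.addRight 1)
  have h3 := hf.continuous
  refine Continuous.bounded_above_of_compact_support (f := generator b f) ?_ ?_
  · unfold generator; fun_prop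
  · exact (hc.deriv.mul_left (f := fun x => -b * x)).add
      ((h2.sub hc).mul_left (f := fun x : ℝ => x))

lemma IsProcess.dynkin_of_hasCompactSupport [IsProbabilityMeasure P] (hZ : IsProcess b ℱ P Z) {f : ℝ → ℝ}
    (hf : ContDiff ℝ (⊤ : ℕ∞) f) (hc : HasCompactSupport f) (hs : tsupport f ⊆ Ioi 0) :
    Dynkin b ℱ P Z f := by
  intro s t hst A hA
  obtain ⟨C, hC⟩ := exists_bound_generator b hf hc
  obtain ⟨C', hC'⟩ := hf.continuous.bounded_above_of_compact_support hc
  have hM := hZ.martingale f hf hc hs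
  have hG : Measurable (fun p : ℝ × Ω => generator b f (Z p.1.toNNReal p.2)) :=
    (measurable_generator b hf.continuous.measurable).comp hZ.measurable_uncurry
  have hfi : ∀ t, Integrable (fun ω => f (Z t ω)) P := fun t =>
    Integrable.of_bound (hf.continuous.measurable.comp (hZ.measurable t)).aestronglyMeasurable C'
      (ae_of_all _ fun ω => hC' _)
  have hIi : ∀ t : ℝ≥0,
      Integrable (fun ω => ∫ r in (0 : ℝ)..t, generator b f (Z r.toNNReal ω)) P := fun t => by
    refine ((hfi t).sub (hM.integrable t)).congr (ae_of_all _ fun ω => ?_)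
    simp
  have hpath : ∀ ω (x y : ℝ),
      IntervalIntegrable (fun r => generator b f (Z r.toNNReal ω)) volume x y := fun ω x y =>
    (intervalIntegrable_const (c := C)).mono_fun
      (hG.comp (measurable_id.prodMk measurable_const)).aestronglyMeasurable
      (ae_of_all _ fun r => (hC _).trans (le_abs_self C))
  have hswap : ∫ r in (s : ℝ)..t, ∫ ω in A, generator b f (Z r.toNNReal ω) ∂P =
      ∫ ω in A, (∫ r in (s : ℝ)..t, generator b f (Z r.toNNReal ω)) ∂P := by
    simp_rw [intervalIntegral.integral_of_le (NNReal.coe_le_coe.2 hst)]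
    refine integral_integral_swap ?_
    exact Integrable.of_bound hG.aestronglyMeasurable C (ae_of_all _ fun p => hC _)
  have hkey := hM.setIntegral_eq hst hA
  rw [integral_sub (hfi s).integrableOn (hIi s).integrableOn,
    integral_sub (hfi t).integrableOn (hIi t).integrableOn] at hkey
  have hsub : ∫ ω in A, (∫ r in (s : ℝ)..t, generator b f (Z r.toNNReal ω)) ∂P =
      ∫ ω in A, (∫ r in (0 : ℝ)..t, generator b f (Z r.toNNReal ω)) ∂P -
      ∫ ω in A, (∫ r in (0 : ℝ)..s, generator b f (Z r.toNNReal ω)) ∂P := by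
    rw [← integral_sub (hIi t).integrableOn (hIi s).integrableOn]
    refine integral_congr_ae (ae_of_all _ fun ω => ?_)
    exact (intervalIntegral.integral_interval_sub_left (hpath ω _ _) (hpath ω _ _)).symm
  rw [hswap, hsub]
  linarith

/-- The moments of order `k` of `1 + Z` are finite and locally bounded in time. -/
def LocBddMoment (P : Measure Ω) (Z : ℝ≥0 → Ω → ℝ) (k : ℕ) : Prop :=
  ∀ T : ℝ≥0, ∃ K : ℝ, ∀ t ≤ T, Integrable (fun ω => (1 + Z t ω) ^ k) P ∧
    ∫ ω, (1 + Z t ω) ^ k ∂P ≤ K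

lemma locBddMoment_zero [IsProbabilityMeasure P] : LocBddMoment P Z 0 := fun _ => ⟨1, fun t _ => by simp⟩

lemma IsProcess.integrable_comp (hZ : IsProcess b ℱ P Z) {k : ℕ} (hk : LocBddMoment P Z k)
    {F : ℝ → ℝ} (hF : Measurable F) {C : ℝ} (hC : ∀ x, 0 < x → |F x| ≤ C * (1 + x) ^ k) (t : ℝ≥0) :
    Integrable (fun ω => F (Z t ω)) P := by
  obtain ⟨K, hK⟩ := hk t
  exact ((hK t le_rfl).1.const_mul C).mono' (hF.comp (hZ.measurable t)).aestronglyMeasurable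
    (ae_of_all _ fun ω => hC _ (hZ.pos t ω))

lemma IsProcess.abs_setIntegral_comp_le (hZ : IsProcess b ℱ P Z) {k : ℕ} {C K : ℝ} {t : ℝ≥0}
    (hi : Integrable (fun ω => (1 + Z t ω) ^ k) P) (hK : ∫ ω, (1 + Z t ω) ^ k ∂P ≤ K)
    (hC0 : 0 ≤ C) {F : ℝ → ℝ} (hC : ∀ x, 0 < x → |F x| ≤ C * (1 + x) ^ k) (A : Set Ω) :
    ‖∫ ω in A, F (Z t ω) ∂P‖ ≤ C * K := by
  have hnn : ∀ ω, 0 ≤ (1 + Z t ω) ^ k := fun ω => by have := hZ.pos t ω; positivity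
  calc ‖∫ ω in A, F (Z t ω) ∂P‖ ≤ ∫ ω in A, C * (1 + Z t ω) ^ k ∂P :=
        norm_integral_le_of_norm_le (hi.const_mul C).integrableOn
          (ae_of_all _ fun ω => hC _ (hZ.pos t ω))
    _ ≤ ∫ ω, C * (1 + Z t ω) ^ k ∂P :=
        setIntegral_le_integral (hi.const_mul C)
          (ae_of_all _ fun ω => mul_nonneg hC0 (hnn ω))
    _ ≤ C * K := by
        rw [integral_const_mul]
        exact mul_le_mul_of_nonneg_left hK hC0

lemma IsProcess.stronglyMeasurable_setIntegral_comp [SFinite P] (hZ : IsProcess b ℱ P Z)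
    {F : ℝ → ℝ} (hF : Measurable F) (A : Set Ω) :
    StronglyMeasurable (fun r : ℝ => ∫ ω in A, F (Z r.toNNReal ω) ∂P) :=
  StronglyMeasurable.integral_prod_right (f := fun (r : ℝ) ω => F (Z r.toNNReal ω))
    (hF.comp hZ.measurable_uncurry).stronglyMeasurable

lemma toNNReal_le_of_mem_uIoc {s t : ℝ≥0} (hst : s ≤ t) {r : ℝ} (hr : r ∈ uIoc (s : ℝ) t) :
    r.toNNReal ≤ t := by
  rw [uIoc_of_le (NNReal.coe_le_coe.2 hst)] at hr
  exact Real.toNNReal_le_iff_le_coe.2 hr.2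

lemma IsProcess.intervalIntegrable_setIntegral_comp [IsProbabilityMeasure P] (hZ : IsProcess b ℱ P Z) {k : ℕ}
    (hk : LocBddMoment P Z k) {F : ℝ → ℝ} (hF : Measurable F) {C : ℝ} (hC0 : 0 ≤ C)
    (hC : ∀ x, 0 < x → |F x| ≤ C * (1 + x) ^ k) (A : Set Ω) {s t : ℝ≥0} (hst : s ≤ t) :
    IntervalIntegrable (fun r : ℝ => ∫ ω in A, F (Z r.toNNReal ω) ∂P) volume s t := by
  obtain ⟨K, hK⟩ := hk t
  refine (intervalIntegrable_const (c := C * K)).mono_fun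
    (hZ.stronglyMeasurable_setIntegral_comp hF A).aestronglyMeasurable
    ((ae_restrict_iff' measurableSet_uIoc).2 (ae_of_all _ fun r hr => ?_))
  obtain ⟨h1, h2⟩ := hK r.toNNReal (toNNReal_le_of_mem_uIoc hst hr)
  exact (hZ.abs_setIntegral_comp_le h1 h2 hC0 hC A).trans (le_abs_self _)

/-- `f` is measurable, smooth on `(0, ∞)`, and both `f` and `𝒢 f` grow at most like
`(1 + x) ^ k`. -/
structure HasGrowth (b : ℝ) (k : ℕ) (f : ℝ → ℝ) : Prop where
  meas : Measurable f
  smooth : ∀ x, 0 < x → ContDiffAt ℝ (⊤ : ℕ∞) f x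
  bound : ∃ C, 0 ≤ C ∧ ∀ x, 0 < x → |f x| ≤ C * (1 + x) ^ k ∧ |generator b f x| ≤ C * (1 + x) ^ k

/-- Dynkin's formula extends from compactly supported functions to functions whose growth is
controlled by a locally bounded moment, by dominated convergence along the cutoffs of
`exists_cutoff`. -/
lemma IsProcess.dynkin_of_hasGrowth [IsProbabilityMeasure P] (hZ : IsProcess b ℱ P Z) {k : ℕ} (hk : LocBddMoment P Z k)
    {f : ℝ → ℝ} (hf : HasGrowth b k f) : Dynkin b ℱ P Z f := by
  obtain ⟨C, hC0, hC⟩ := hf.bound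
  obtain ⟨χ, D, hD0, hχ⟩ := exists_cutoff
  intro s t hst A hA
  set F : ℕ → ℝ → ℝ := fun n x => f x * χ n x with hFdef
  have hFs : ∀ n, ContDiff ℝ (⊤ : ℕ∞) (F n) := by
    intro n
    refine contDiff_iff_contDiffAt.2 fun x => ?_
    by_cases hx : x ∈ tsupport (χ n)
    · exact (hf.smooth x ((hχ n).2.2.1 hx)).mul (hχ n).1.contDiffAt
    · refine (contDiffAt_const (c := (0 : ℝ))).congr_of_eventuallyEq ?_
      filter_upwards [notMem_tsupport_iff_eventuallyEq.1 hx] with y hy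
      simp [hFdef, hy]
  have hFdyn : ∀ n, Dynkin b ℱ P Z (F n) := fun n =>
    hZ.dynkin_of_hasCompactSupport (hFs n) ((hχ n).2.1.mul_left)
      ((tsupport_mul_subset_right).trans (hχ n).2.2.1)
  have hFb : ∀ n x, 0 < x → |F n x| ≤ C * (1 + x) ^ k := by
    intro n x hx
    rw [abs_mul]
    exact (mul_le_of_le_one_right (abs_nonneg _) ((hχ n).2.2.2.1 x)).trans (hC x hx).1
  have hgen : ∀ n x, 0 < x → generator b (F n) x = χ n x * generator b f x -
      b * f x * (x * deriv (χ n) x) + f (x + 1) * (x * (χ n (x + 1) - χ n x)) := fun n x hx =>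
    generator_mul b ((hf.smooth x hx).differentiableAt (by simp))
      ((hχ n).1.differentiable (by simp) x)
  set C' : ℝ := C + |b| * C * D + C * 2 ^ k * D with hC'
  have hC'0 : 0 ≤ C' := by positivity
  have hGb : ∀ n x, 0 < x → |generator b (F n) x| ≤ C' * (1 + x) ^ k := by
    intro n x hx
    have a1 : |χ n x * generator b f x| ≤ C * (1 + x) ^ k := by
      rw [abs_mul]
      exact (mul_le_of_le_one_left (abs_nonneg _) ((hχ n).2.2.2.1 x)).trans (hC x hx).2
    have a2 : |b * f x * (x * deriv (χ n) x)| ≤ |b| * (C * (1 + x) ^ k) * D := by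
      rw [abs_mul, abs_mul b]
      exact mul_le_mul (mul_le_mul_of_nonneg_left (hC x hx).1 (abs_nonneg _))
        ((hχ n).2.2.2.2.1 x) (abs_nonneg _) (by positivity)
    have a3 : |f (x + 1) * (x * (χ n (x + 1) - χ n x))| ≤ C * (2 ^ k * (1 + x) ^ k) * D := by
      rw [abs_mul]
      refine mul_le_mul (((hC (x + 1) (by linarith)).1).trans ?_)
        ((hχ n).2.2.2.2.2.1 x hx) (abs_nonneg _) (by positivity)
      rw [← mul_pow]
      exact mul_le_mul_of_nonneg_left (pow_le_pow_left₀ (by linarith) (by linarith) _) hC0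
    rw [hgen n x hx]
    calc _ ≤ |χ n x * generator b f x| + |b * f x * (x * deriv (χ n) x)| +
          |f (x + 1) * (x * (χ n (x + 1) - χ n x))| :=
          (abs_add_le _ _).trans (add_le_add_left (abs_sub _ _) _)
      _ ≤ C * (1 + x) ^ k + |b| * (C * (1 + x) ^ k) * D + C * (2 ^ k * (1 + x) ^ k) * D := by
          gcongr
      _ = C' * (1 + x) ^ k := by rw [hC']; ring
  -- the cutoffs are eventually equal to `1` near any point of `(0, ∞)`
  have hone : ∀ x, 0 < x → ∀ᶠ n in atTop, χ n =ᶠ[𝓝 x] fun _ => 1 := by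
    intro x hx
    have h1 : Tendsto (fun n : ℕ => (2 / (n + 1) : ℝ)) atTop (𝓝 0) := by
      simpa [div_eq_mul_inv] using (tendsto_one_div_add_atTop_nhds_zero_nat (𝕜 := ℝ)).const_mul 2
    have h2 : Tendsto (fun n : ℕ => (n + 1 : ℝ)) atTop atTop :=
      tendsto_atTop_add_const_right _ _ tendsto_natCast_atTop_atTop
    filter_upwards [h1.eventually (gt_mem_nhds hx), h2.eventually_gt_atTop x] with n hn1 hn2
    filter_upwards [Ioo_mem_nhds hn1 hn2] with y hy
    exact (hχ n).2.2.2.2.2.2 y hy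
  have hFl : ∀ x, 0 < x → Tendsto (fun n => F n x) atTop (𝓝 (f x)) := by
    intro x hx
    refine tendsto_const_nhds.congr' ?_
    filter_upwards [hone x hx] with n hn
    simp [hFdef, hn.eq_of_nhds]
  have hGl : ∀ x, 0 < x → Tendsto (fun n => generator b (F n) x) atTop (𝓝 (generator b f x)) := by
    intro x hx
    refine tendsto_const_nhds.congr' ?_
    filter_upwards [hone x hx, hone (x + 1) (by linarith)] with n hn hn1
    rw [hgen n x hx, hn.deriv_eq, hn.eq_of_nhds, hn1.eq_of_nhds]
    simp
  have hFm : ∀ n, Measurable (F n) := fun n => (hFs n).continuous.measurable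
  have hlim : ∀ (H : ℕ → ℝ → ℝ) (h : ℝ → ℝ) (c : ℝ), (∀ n, Measurable (H n)) →
      (∀ n x, 0 < x → |H n x| ≤ c * (1 + x) ^ k) →
      (∀ x, 0 < x → Tendsto (fun n => H n x) atTop (𝓝 (h x))) → ∀ r : ℝ≥0,
      Tendsto (fun n => ∫ ω in A, H n (Z r ω) ∂P) atTop (𝓝 (∫ ω in A, h (Z r ω) ∂P)) := by
    intro H h c hm hb hl r
    obtain ⟨K, hK⟩ := hk r
    exact tendsto_integral_of_dominated_convergence (fun ω => c * (1 + Z r ω) ^ k)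
      (fun n => ((hm n).comp (hZ.measurable r)).aestronglyMeasurable)
      ((hK r le_rfl).1.const_mul c).integrableOn
      (fun n => ae_of_all _ fun ω => hb n _ (hZ.pos r ω))
      (ae_of_all _ fun ω => hl _ (hZ.pos r ω))
  have L1 := hlim F f C hFm hFb hFl t
  have L2 := hlim F f C hFm hFb hFl s
  have L3 : Tendsto (fun n => ∫ r in (s : ℝ)..t, ∫ ω in A, generator b (F n) (Z r.toNNReal ω) ∂P)
      atTop (𝓝 (∫ r in (s : ℝ)..t, ∫ ω in A, generator b f (Z r.toNNReal ω) ∂P)) := by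
    obtain ⟨K, hK⟩ := hk t
    refine intervalIntegral.tendsto_integral_filter_of_dominated_convergence (fun _ => C' * K)
      (Eventually.of_forall fun n => (hZ.stronglyMeasurable_setIntegral_comp
        (measurable_generator b (hFm n)) A).aestronglyMeasurable)
      (Eventually.of_forall fun n => ae_of_all _ fun r hr => ?_) intervalIntegrable_const
      (ae_of_all _ fun r _ => hlim _ _ C' (fun n => measurable_generator b (hFm n)) hGb hGl _)
    obtain ⟨h1, h2⟩ := hK r.toNNReal (toNNReal_le_of_mem_uIoc hst hr)
    exact hZ.abs_setIntegral_comp_le h1 h2 hC'0 (hGb n) A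
  refine tendsto_nhds_unique L1 ((L2.add L3).congr fun n => ?_)
  exact (hFdyn n s t hst A hA).symm

/-- Dynkin's formula with the integrating factor `exp (-c r)`. -/
lemma IsProcess.exp_mul_setIntegral_eq [IsProbabilityMeasure P] (hZ : IsProcess b ℱ P Z) {k : ℕ} (hk : LocBddMoment P Z k)
    {f : ℝ → ℝ} (hf : HasGrowth b k f) (c : ℝ) {s t : ℝ≥0} (hst : s ≤ t) {A : Set Ω}
    (hA : MeasurableSet[ℱ s] A) :
    Real.exp (-c * (t - s)) * ∫ ω in A, f (Z t ω) ∂P = ∫ ω in A, f (Z s ω) ∂P +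
      ∫ r in (s : ℝ)..t, Real.exp (-c * (r - s)) *
        (∫ ω in A, generator b f (Z r.toNNReal ω) ∂P - c * ∫ ω in A, f (Z r.toNNReal ω) ∂P) := by
  obtain ⟨C, hC0, hC⟩ := hf.bound
  have h := exp_mul_eq_add_integral (u := fun r => ∫ ω in A, f (Z r.toNNReal ω) ∂P)
    (v := fun r => ∫ ω in A, generator b f (Z r.toNNReal ω) ∂P) c (NNReal.coe_le_coe.2 hst)
    (hZ.intervalIntegrable_setIntegral_comp hk (measurable_generator b hf.meas) hC0
      (fun x hx => (hC x hx).2) A hst)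
    (fun r hr => by
      have hr0 : 0 ≤ r := s.coe_nonneg.trans hr.1
      have := hZ.dynkin_of_hasGrowth hk hf s r.toNNReal (NNReal.le_toNNReal_of_coe_le hr.1) A hA
      simpa [Real.coe_toNNReal r hr0] using this)
  simpa using h

/-- Gronwall's inequality for expectations along the process. -/
lemma IsProcess.exp_mul_integral_le [IsProbabilityMeasure P] (hZ : IsProcess b ℱ P Z) {k : ℕ} (hk : LocBddMoment P Z k)
    {f : ℝ → ℝ} (hf : HasGrowth b k f) (c : ℝ) {H : ℝ → ℝ} (hH : Continuous H)
    (h : ∀ r : ℝ≥0, ∫ ω, generator b f (Z r ω) ∂P ≤ c * ∫ ω, f (Z r ω) ∂P + H r) (t : ℝ≥0) :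
    Real.exp (-c * t) * ∫ ω, f (Z t ω) ∂P ≤ f 1 + ∫ r in (0 : ℝ)..t, Real.exp (-c * r) * H r := by
  obtain ⟨C, hC0, hC⟩ := hf.bound
  have key := hZ.exp_mul_setIntegral_eq hk hf c (zero_le (a := t)) (A := univ) MeasurableSet.univ
  simp only [Measure.restrict_univ, NNReal.coe_zero, sub_zero] at key
  have h0 : ∫ ω, f (Z 0 ω) ∂P = f 1 := by
    rw [integral_congr_ae (g := fun _ => f 1) (by filter_upwards [hZ.init] with ω hω; rw [hω])]
    simp
  rw [key, h0]
  have i1 := hZ.intervalIntegrable_setIntegral_comp hk (measurable_generator b hf.meas) hC0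
      (fun x hx => (hC x hx).2) univ (zero_le (a := t))
  have i2 := hZ.intervalIntegrable_setIntegral_comp hk hf.meas hC0
      (fun x hx => (hC x hx).1) univ (zero_le (a := t))
  simp only [Measure.restrict_univ, NNReal.coe_zero] at i1 i2
  gcongr
  refine intervalIntegral.integral_mono_on t.coe_nonneg
    ((i1.sub (i2.const_mul c)).continuousOn_mul (by fun_prop))
    (Continuous.intervalIntegrable (by fun_prop) _ _) fun r hr => ?_
  have := h r.toNNReal
  rw [Real.coe_toNNReal r hr.1] at this
  exact mul_le_mul_of_nonneg_left (by linarith) (Real.exp_pos _).le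

end Dynkin

lemma integral_exp_const_mul {c : ℝ} (hc : c ≠ 0) (x y : ℝ) :
    ∫ r in x..y, Real.exp (c * r) = (Real.exp (c * y) - Real.exp (c * x)) / c := by
  rw [intervalIntegral.integral_comp_mul_left (fun x => Real.exp x) hc, integral_exp, smul_eq_mul,
    inv_mul_eq_div]

/-! ### Moments and the martingale property -/

section Moments

variable {Ω : Type*} {mΩ : MeasurableSpace Ω} {b : ℝ} {ℱ : Filtration ℝ≥0 mΩ}
    {P : Measure Ω} {Z : ℝ≥0 → Ω → ℝ}

lemma hasGrowth_lyap {ε : ℝ} (hb0 : 0 ≤ b) (hε : 0 < ε) (hε1 : ε ≤ 1) (k : ℕ) :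
    HasGrowth b 0 (lyap ε (k + 1)) where
  meas := by unfold lyap; fun_prop
  smooth x hx := by
    have : 1 + ε * x ≠ 0 := by positivity
    unfold lyap
    fun_prop (disch := assumption)
  bound := by
    have hM : (0 : ℝ) ≤ (1 / ε) ^ (k + 1) := by positivity
    have hc : (0 : ℝ) ≤ (k + 1) * 2 ^ k := by positivity
    have hd : (0 : ℝ) ≤ b * (k + 1) := by positivity
    refine ⟨(1 + (k + 1) * 2 ^ k + b * (k + 1)) * (1 / ε) ^ (k + 1), by positivity, fun x hx => ?_⟩
    have h0 := lyap_nonneg hε.le (k + 1) hx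
    have h1 := lyap_le hε hε1 (k + 1) hx
    obtain ⟨h2, h3⟩ := generator_lyap_bounds hb0 hε hε1 k hx
    rw [pow_zero, mul_one]
    have h4 := mul_le_mul_of_nonneg_left h1 hc
    have h5 := mul_le_mul_of_nonneg_left h1 hd
    have h6 := mul_nonneg hc hM
    have h7 := mul_nonneg hd hM
    constructor
    · rw [abs_of_nonneg h0]; linarith
    · rw [abs_le]; constructor <;> linarith

lemma hasGrowth_one_add_pow (hb0 : 0 ≤ b) (k : ℕ) :
    HasGrowth b (k + 1) (fun x => (1 + x) ^ (k + 1)) where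
  meas := by fun_prop
  smooth x _ := by fun_prop
  bound := by
    obtain ⟨C, hC0, hC⟩ := exists_abs_generator_one_add_pow_le hb0 k
    refine ⟨C + 1, by positivity, fun x hx => ?_⟩
    have h : 0 ≤ (1 + x) ^ (k + 1) := by positivity
    have h' := mul_nonneg hC0 h
    constructor
    · rw [abs_of_nonneg h]; linarith
    · linarith [hC x hx]

/-- All moments are finite and locally bounded: Gronwall's inequality bounds the expectations of
the functions `lyap ε k` uniformly in `ε`, and Fatou's lemma lets `ε` tend to `0`. -/
lemma IsProcess.locBddMoment [IsProbabilityMeasure P] (hZ : IsProcess b ℱ P Z) (hb0 : 0 ≤ b)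
    (k : ℕ) : LocBddMoment P Z k := by
  rcases k with _ | k
  · exact locBddMoment_zero
  set c : ℝ := (k + 1) * 2 ^ k with hc
  have hc0 : 0 ≤ c := by positivity
  have hlyap : ∀ ε : ℝ, 0 < ε → ε ≤ 1 → ∀ t : ℝ≥0, Integrable (fun ω => lyap ε (k + 1) (Z t ω)) P ∧
      ∫ ω, lyap ε (k + 1) (Z t ω) ∂P ≤ 2 ^ (k + 1) * Real.exp (c * t) := by
    intro ε hε hε1 t
    have hg := hasGrowth_lyap hb0 hε hε1 k
    obtain ⟨C, -, hC⟩ := hg.bound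
    have hi1 : ∀ t, Integrable (fun ω => lyap ε (k + 1) (Z t ω)) P :=
      hZ.integrable_comp locBddMoment_zero hg.meas fun x hx => (hC x hx).1
    have hi2 : ∀ t, Integrable (fun ω => generator b (lyap ε (k + 1)) (Z t ω)) P :=
      hZ.integrable_comp locBddMoment_zero (measurable_generator b hg.meas) fun x hx => (hC x hx).2
    refine ⟨hi1 t, ?_⟩
    have := hZ.exp_mul_integral_le locBddMoment_zero hg c (H := fun _ => 0) continuous_const
      (fun r => by
        rw [add_zero, ← integral_const_mul]
        exact integral_mono (hi2 r) ((hi1 r).const_mul c) fun ω =>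
          (generator_lyap_bounds hb0 hε hε1 k (hZ.pos r ω)).1) t
    simp only [mul_zero, intervalIntegral.integral_zero, add_zero] at this
    have h1 : lyap ε (k + 1) 1 ≤ 2 ^ (k + 1) := by
      refine pow_le_pow_left₀ (by positivity) ?_ _
      rw [div_le_iff₀ (by positivity)]
      linarith
    have h2 : Real.exp (-c * t) = (Real.exp (c * t))⁻¹ := by rw [← Real.exp_neg]; ring_nf
    rw [h2, inv_mul_le_iff₀ (Real.exp_pos _)] at this
    calc _ ≤ _ := this
      _ ≤ Real.exp (c * t) * 2 ^ (k + 1) := by gcongr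
      _ = _ := mul_comm _ _
  intro T
  refine ⟨2 ^ (k + 1) * Real.exp (c * T), fun t ht => ?_⟩
  have hnn : ∀ ω, 0 ≤ (1 + Z t ω) ^ (k + 1) := fun ω => by have := hZ.pos t ω; positivity
  have hm : Measurable (fun ω => (1 + Z t ω) ^ (k + 1)) :=
    ((hZ.measurable t).const_add 1).pow_const _
  have hlim : ∀ x : ℝ, 0 < x →
      Tendsto (fun n : ℕ => lyap (1 / (n + 1)) (k + 1) x) atTop (𝓝 ((1 + x) ^ (k + 1))) := by
    intro x hx
    have h1 : Tendsto (fun n : ℕ => 1 + (1 / (n + 1) : ℝ) * x) atTop (𝓝 (1 + 0 * x)) :=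
      (tendsto_one_div_add_atTop_nhds_zero_nat.mul_const x).const_add 1
    have h2 := ((tendsto_const_nhds (x := 1 + x)).div h1 (by simp)).pow (k + 1)
    simpa [lyap] using h2
  have hfatou : ∫⁻ ω, ENNReal.ofReal ((1 + Z t ω) ^ (k + 1)) ∂P ≤
      ENNReal.ofReal (2 ^ (k + 1) * Real.exp (c * T)) := by
    calc ∫⁻ ω, ENNReal.ofReal ((1 + Z t ω) ^ (k + 1)) ∂P
        = ∫⁻ ω, liminf (fun n : ℕ => ENNReal.ofReal (lyap (1 / (n + 1)) (k + 1) (Z t ω))) atTop ∂P :=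
          lintegral_congr fun ω =>
            ((ENNReal.tendsto_ofReal (hlim _ (hZ.pos t ω))).liminf_eq).symm
      _ ≤ liminf (fun n : ℕ =>
            ∫⁻ ω, ENNReal.ofReal (lyap (1 / (n + 1)) (k + 1) (Z t ω)) ∂P) atTop := by
          refine lintegral_liminf_le fun n => ENNReal.measurable_ofReal.comp ?_
          have : Measurable (lyap (1 / (n + 1)) (k + 1)) := by unfold lyap; fun_prop
          exact this.comp (hZ.measurable t)
      _ ≤ ENNReal.ofReal (2 ^ (k + 1) * Real.exp (c * T)) := by
          refine liminf_le_of_frequently_le' (Frequently.of_forall fun n => ?_)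
          have hn0 : (0 : ℝ) < 1 / (n + 1) := by positivity
          have hn1 : (1 : ℝ) / (n + 1) ≤ 1 := by
            rw [div_le_one (by positivity)]; linarith [n.cast_nonneg (α := ℝ)]
          obtain ⟨i1, i2⟩ := hlyap _ hn0 hn1 t
          rw [← ofReal_integral_eq_lintegral_ofReal i1
            (ae_of_all _ fun ω => lyap_nonneg hn0.le _ (hZ.pos t ω))]
          refine ENNReal.ofReal_le_ofReal (i2.trans ?_)
          gcongr
  constructor
  · refine ⟨hm.aestronglyMeasurable, ?_⟩
    rw [hasFiniteIntegral_iff_ofReal (ae_of_all _ hnn)]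
    exact hfatou.trans_lt ENNReal.ofReal_lt_top
  · rw [integral_eq_lintegral_of_nonneg_ae (ae_of_all _ hnn) hm.aestronglyMeasurable]
    exact ENNReal.toReal_le_of_le_ofReal (by positivity) hfatou

/-- The `k`-th moment grows at most like `exp (k (1 - b) t)`: by induction on `k`, since the drift
of `(1 + x) ^ (k + 1)` exceeds `(k + 1) (1 - b) (1 + x) ^ (k + 1)` only by a multiple of
`(1 + x) ^ k`. -/
lemma IsProcess.exists_moment_le [IsProbabilityMeasure P] (hZ : IsProcess b ℱ P Z) (hb0 : 0 ≤ b)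
    (hb1 : b < 1) (k : ℕ) : ∃ C : ℝ, 0 ≤ C ∧ ∀ t : ℝ≥0,
      ∫ ω, (1 + Z t ω) ^ k ∂P ≤ C * Real.exp (k * (1 - b) * t) := by
  induction k with
  | zero => exact ⟨1, zero_le_one, fun t => by simp⟩
  | succ k ih =>
    obtain ⟨C, hC0, hC⟩ := ih
    obtain ⟨D, hD0, hD⟩ := exists_generator_one_add_pow_le hb0 k
    have ha : 0 < 1 - b := by linarith
    refine ⟨2 ^ (k + 1) + D * C / (1 - b), by positivity, fun t => ?_⟩
    have hint : ∀ (k : ℕ) (t : ℝ≥0), Integrable (fun ω => (1 + Z t ω) ^ k) P := fun k t => by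
      obtain ⟨K, hK⟩ := hZ.locBddMoment hb0 k t
      exact (hK t le_rfl).1
    have hg := hasGrowth_one_add_pow hb0 k
    obtain ⟨C', -, hC'⟩ := hg.bound
    have hG := hZ.integrable_comp (hZ.locBddMoment hb0 (k + 1)) (measurable_generator b hg.meas)
      fun x hx => (hC' x hx).2
    have key := hZ.exp_mul_integral_le (hZ.locBddMoment hb0 (k + 1)) hg ((k + 1) * (1 - b))
      (H := fun r => D * (C * Real.exp (k * (1 - b) * r))) (by fun_prop) (fun r => by
        calc ∫ ω, generator b (fun x => (1 + x) ^ (k + 1)) (Z r ω) ∂P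
            ≤ ∫ ω, ((k + 1) * (1 - b) * (1 + Z r ω) ^ (k + 1) + D * (1 + Z r ω) ^ k) ∂P :=
              integral_mono (hG r) (((hint _ r).const_mul _).add ((hint _ r).const_mul _))
                fun ω => hD _ (hZ.pos r ω)
          _ = (k + 1) * (1 - b) * ∫ ω, (1 + Z r ω) ^ (k + 1) ∂P +
              D * ∫ ω, (1 + Z r ω) ^ k ∂P := by
              rw [integral_add ((hint _ r).const_mul _) ((hint _ r).const_mul _),
                integral_const_mul, integral_const_mul]
          _ ≤ _ := by
              gcongr
              exact hC r) t
    have hI : ∫ r in (0 : ℝ)..t, Real.exp (-((k + 1) * (1 - b)) * r) *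
        (D * (C * Real.exp (k * (1 - b) * r))) ≤ D * C / (1 - b) := by
      have e : ∀ r : ℝ, Real.exp (-((k + 1) * (1 - b)) * r) *
          (D * (C * Real.exp (k * (1 - b) * r))) = D * C * Real.exp (-(1 - b) * r) := by
        intro r
        rw [show -(1 - b) * r = -((k + 1) * (1 - b)) * r + k * (1 - b) * r by ring, Real.exp_add]
        ring
      simp_rw [e]
      rw [intervalIntegral.integral_const_mul, integral_exp_const_mul (neg_ne_zero.2 ha.ne'),
        mul_zero, Real.exp_zero, div_eq_mul_one_div (D * C)]
      refine mul_le_mul_of_nonneg_left ?_ (by positivity)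
      rw [← neg_div_neg_eq, neg_neg, div_le_div_iff_of_pos_right ha]
      linarith [Real.exp_pos (-(1 - b) * t)]
    have h2 : Real.exp (-((k + 1) * (1 - b)) * t) = (Real.exp ((k + 1) * (1 - b) * t))⁻¹ := by
      rw [← Real.exp_neg]; ring_nf
    rw [h2, inv_mul_le_iff₀ (Real.exp_pos _)] at key
    push_cast
    refine key.trans ?_
    rw [mul_comm]
    gcongr
    norm_num

lemma IsProcess.W_pos (hZ : IsProcess b ℱ P Z) (t : ℝ≥0) (ω : Ω) : 0 < W b Z t ω :=
  mul_pos (Real.exp_pos _) (hZ.pos t ω)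

lemma IsProcess.measurable_W (hZ : IsProcess b ℱ P Z) (t : ℝ≥0) : Measurable (W b Z t) :=
  (hZ.measurable t).const_mul _

lemma IsProcess.right_cont_W (hZ : IsProcess b ℱ P Z) (ω : Ω) (t : ℝ≥0) :
    ContinuousWithinAt (fun t => W b Z t ω) (Ici t) t := by
  have h : Continuous (fun t : ℝ≥0 => Real.exp (-(1 - b) * t)) := by fun_prop
  exact h.continuousWithinAt.mul ((hZ.cadlag ω).right_cont t)

lemma IsProcess.exists_moment_W_le [IsProbabilityMeasure P] (hZ : IsProcess b ℱ P Z) (hb0 : 0 ≤ b)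
    (hb1 : b < 1) (k : ℕ) : ∃ C : ℝ, 0 ≤ C ∧ ∀ t : ℝ≥0, Integrable (fun ω => W b Z t ω ^ k) P ∧
      ∫ ω, W b Z t ω ^ k ∂P ≤ C := by
  obtain ⟨C, hC0, hC⟩ := hZ.exists_moment_le hb0 hb1 k
  refine ⟨C, hC0, fun t => ?_⟩
  obtain ⟨K, hK⟩ := hZ.locBddMoment hb0 k t
  have hb : ∀ ω, W b Z t ω ^ k ≤ Real.exp (-(k * (1 - b) * t)) * (1 + Z t ω) ^ k := by
    intro ω
    have hz := hZ.pos t ω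
    rw [W, mul_pow, ← Real.exp_nat_mul]
    rw [show (k : ℝ) * (-(1 - b) * t) = -(k * (1 - b) * t) by ring]
    gcongr
    linarith
  have hi : Integrable (fun ω => W b Z t ω ^ k) P :=
    ((hK t le_rfl).1.const_mul _).mono' ((hZ.measurable_W t).pow_const k).aestronglyMeasurable
      (ae_of_all _ fun ω => by
        rw [Real.norm_eq_abs, abs_of_nonneg (pow_nonneg (hZ.W_pos t ω).le k)]
        exact hb ω)
  refine ⟨hi, (integral_mono hi ((hK t le_rfl).1.const_mul _) hb).trans ?_⟩
  rw [integral_const_mul, Real.exp_neg, inv_mul_le_iff₀ (Real.exp_pos _), mul_comm]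
  exact hC t

lemma IsProcess.martingale_W [IsProbabilityMeasure P] (hZ : IsProcess b ℱ P Z) (hb0 : 0 ≤ b)
    (hb1 : b < 1) : Martingale (W b Z) ℱ P := by
  have hint : ∀ t, Integrable (W b Z t) P := fun t => by
    obtain ⟨C, -, hC⟩ := hZ.exists_moment_W_le hb0 hb1 1
    simpa using (hC t).1
  have hadp : StronglyAdapted ℱ (W b Z) := fun t => (hZ.adapted t).const_mul _
  have hgen : ∀ x, generator b (fun x => x) x = (1 - b) * x := fun x => by
    simp only [generator, deriv_id'']; ring
  have hg : HasGrowth b 1 (fun x => x) :=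
    { meas := measurable_id
      smooth := fun x _ => contDiffAt_id
      bound := ⟨1, zero_le_one, fun x hx => by
        rw [hgen, abs_mul, abs_of_pos hx, abs_of_pos (show 0 < 1 - b by linarith)]
        constructor
        · linarith
        · nlinarith⟩ }
  refine ⟨hadp, fun s t hst => (ae_eq_condExp_of_forall_setIntegral_eq (ℱ.le s) (hint t)
    (fun A _ _ => (hint s).integrableOn) (fun A hA _ => ?_)
    (hadp s).aestronglyMeasurable).symm⟩
  have key := hZ.exp_mul_setIntegral_eq (hZ.locBddMoment hb0 1) hg (1 - b) hst hA
  simp_rw [hgen, integral_const_mul, sub_self, mul_zero] at key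
  rw [intervalIntegral.integral_zero, add_zero] at key
  simp only [W]
  rw [integral_const_mul, integral_const_mul, ← key, ← mul_assoc, ← Real.exp_add]
  ring_nf

/-- The exponent `k` is real here; the moment of the next larger integer order dominates. -/
lemma IsProcess.exists_eLpNorm_W_le [IsProbabilityMeasure P] (hZ : IsProcess b ℱ P Z)
    (hb0 : 0 ≤ b) (hb1 : b < 1) (k : ℝ≥0) : ∃ C : ℝ≥0, ∀ t : ℝ≥0, eLpNorm (W b Z t) k P ≤ C := by
  set m : ℕ := ⌈k⌉₊ + 1 with hm
  obtain ⟨C, hC0, hC⟩ := hZ.exists_moment_W_le hb0 hb1 m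
  refine ⟨(C ^ (1 / (m : ℝ))).toNNReal, fun t => ?_⟩
  have hkm : (k : ℝ≥0∞) ≤ (m : ℝ≥0∞) := by
    have : k ≤ (m : ℝ≥0) := (Nat.le_ceil k).trans (by simp [hm])
    exact_mod_cast this
  refine (eLpNorm_le_eLpNorm_of_exponent_le hkm (hZ.measurable_W t).aestronglyMeasurable).trans ?_
  obtain ⟨h1, h2⟩ := hC t
  rw [eLpNorm_eq_lintegral_rpow_enorm_toReal (by simp [hm]) (by simp)]
  simp only [ENNReal.toReal_natCast]
  have e : ∀ ω, ‖W b Z t ω‖ₑ ^ (m : ℝ) = ENNReal.ofReal (W b Z t ω ^ m) := fun ω => by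
    rw [ENNReal.rpow_natCast, Real.enorm_of_nonneg (hZ.W_pos t ω).le,
      ENNReal.ofReal_pow (hZ.W_pos t ω).le]
  simp_rw [e]
  rw [← ofReal_integral_eq_lintegral_ofReal h1
    (ae_of_all _ fun ω => pow_nonneg (hZ.W_pos t ω).le m)]
  refine (ENNReal.rpow_le_rpow (ENNReal.ofReal_le_ofReal h2) (by positivity)).trans ?_
  rw [ENNReal.ofReal_rpow_of_nonneg hC0 (by positivity)]
  rfl

end Moments

/-! ### Maximal inequality and convergence of right-continuous martingales -/

section Martingales

variable {Ω : Type*} {mΩ : MeasurableSpace Ω} {P : Measure Ω}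

/-- Doob's maximal inequality, after removal of the part of `|M n|` below `c / 2`. -/
lemma maximal_ineq_abs [IsFiniteMeasure P] {𝒢 : Filtration ℕ mΩ} {M : ℕ → Ω → ℝ}
    (hM : Martingale M 𝒢 P) {c : ℝ} (hc : 0 < c) (n : ℕ) :
    P {ω | ∃ k ≤ n, c ≤ |M k ω|} ≤
      ENNReal.ofReal (2 / c * ∫ ω in {ω | c / 2 ≤ |M n ω|}, |M n ω| ∂P) := by
  have hsub : Submartingale (fun k ω => |M k ω|) 𝒢 P := by
    have := hM.submartingale.sup hM.neg.submartingale
    exact this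
  have hmax := maximal_ineq hsub (fun _ _ => abs_nonneg _) (ε := c.toNNReal) n
  rw [Real.coe_toNNReal c hc.le] at hmax
  have hSeq : {ω | c ≤ (Finset.range (n + 1)).sup' Finset.nonempty_range_add_one
      fun k => |M k ω|} = {ω | ∃ k ≤ n, c ≤ |M k ω|} := by
    ext ω
    simp [Finset.le_sup'_iff]
  rw [hSeq] at hmax
  set S := {ω | ∃ k ≤ n, c ≤ |M k ω|} with hS
  have hi : Integrable (fun ω => |M n ω|) P := (hM.integrable n).abs
  have hmeas : MeasurableSet {ω | c / 2 ≤ |M n ω|} :=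
    measurableSet_le measurable_const
      ((hM.stronglyMeasurable n).mono (𝒢.le n)).measurable.abs
  set J := ∫ ω in {ω | c / 2 ≤ |M n ω|}, |M n ω| ∂P with hJ
  have hSreal : c * P.real S ≤ ∫ ω in S, |M n ω| ∂P := by
    have h := ENNReal.toReal_mono ENNReal.ofReal_ne_top hmax
    rw [ENNReal.toReal_mul, ENNReal.toReal_ofReal (integral_nonneg fun ω => abs_nonneg _)] at h
    simpa [hc.le, Measure.real] using h
  have hsplit : ∫ ω in S, |M n ω| ∂P ≤ c / 2 * P.real S + J := by
    have hind : Integrable ({ω | c / 2 ≤ |M n ω|}.indicator fun ω => |M n ω|) P :=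
      hi.indicator hmeas
    have hind0 : ∀ ω, 0 ≤ ({ω | c / 2 ≤ |M n ω|}.indicator fun ω => |M n ω|) ω :=
      fun ω => indicator_nonneg (fun _ _ => abs_nonneg _) ω
    calc ∫ ω in S, |M n ω| ∂P
        ≤ ∫ ω in S, (c / 2 + ({ω | c / 2 ≤ |M n ω|}.indicator fun ω => |M n ω|) ω) ∂P := by
          refine integral_mono hi.integrableOn
            ((integrable_const _).add hind.integrableOn) fun ω => ?_
          by_cases h : c / 2 ≤ |M n ω|
          · simp only [indicator, mem_ofPred_eq, h, if_true]; linarith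
          · simp only [indicator, mem_ofPred_eq, h, if_false]; linarith
      _ = c / 2 * P.real S + ∫ ω in S, ({ω | c / 2 ≤ |M n ω|}.indicator fun ω => |M n ω|) ω ∂P := by
          rw [integral_add (integrable_const _) hind.integrableOn, setIntegral_const, smul_eq_mul,
            mul_comm]
      _ ≤ _ := by
          rw [hJ, ← integral_indicator hmeas]
          exact add_le_add_right (setIntegral_le_integral hind (ae_of_all _ hind0)) _
  rw [← ENNReal.ofReal_toReal (measure_ne_top P S)]
  refine ENNReal.ofReal_le_ofReal ?_
  change P.real S ≤ _
  rw [div_mul_eq_mul_div, le_div_iff₀ hc]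
  linarith

/-- Sampling a filtration along a nondecreasing sequence of times. -/
def sampledFiltration {ι : Type*} [Preorder ι] (ℱ : Filtration ℝ≥0 mΩ) {τ : ι → ℝ≥0}
    (hτ : Monotone τ) : Filtration ι mΩ where
  seq i := ℱ (τ i)
  mono' _ _ hij := ℱ.mono (hτ hij)
  le' i := ℱ.le (τ i)

lemma martingale_sampled {ι : Type*} [Preorder ι] {ℱ : Filtration ℝ≥0 mΩ} {M : ℝ≥0 → Ω → ℝ}
    (hM : Martingale M ℱ P) {τ : ι → ℝ≥0} (hτ : Monotone τ) :
    Martingale (fun i => M (τ i)) (sampledFiltration ℱ hτ) P :=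
  ⟨fun i => hM.1 (τ i), fun _ _ hij => hM.2 _ _ (hτ hij)⟩

/-- The maximal inequality for a right-continuous martingale over the whole time axis, obtained
along the dyadic grids. -/
lemma measure_exists_lt_abs_le [IsFiniteMeasure P] {ℱ : Filtration ℝ≥0 mΩ} {M : ℝ≥0 → Ω → ℝ}
    (hM : Martingale M ℱ P) (hrc : ∀ ω t, ContinuousWithinAt (fun t => M t ω) (Ici t) t)
    {c K : ℝ} (hc : 0 < c) (hK : ∀ t, ∫ ω in {ω | c / 2 ≤ |M t ω|}, |M t ω| ∂P ≤ K) :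
    P {ω | ∃ t, c < |M t ω|} ≤ ENNReal.ofReal (2 / c * K) := by
  set S : ℕ → Set Ω := fun n => {ω | ∃ k ≤ n * 2 ^ n + 1, c ≤ |M ((k : ℕ) / 2 ^ n) ω|} with hS
  have hSle : ∀ n, P (S n) ≤ ENNReal.ofReal (2 / c * K) := by
    intro n
    have hτ : Monotone (fun k : ℕ => ((k : ℝ≥0) / 2 ^ n)) := fun i j hij => by
      dsimp only
      gcongr
    refine (maximal_ineq_abs (martingale_sampled hM hτ) hc (n * 2 ^ n + 1)).trans ?_
    exact ENNReal.ofReal_le_ofReal (mul_le_mul_of_nonneg_left (hK _) (by positivity))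
  set U : ℕ → Set Ω := fun n => ⋂ m ≥ n, S m with hU
  have hUmono : Monotone U := fun i j hij => by
    refine subset_iInter₂ fun m hm => ?_
    exact iInter₂_subset m (le_trans hij hm)
  have hsub : {ω | ∃ t, c < |M t ω|} ⊆ ⋃ n, U n := by
    rintro ω ⟨t, ht⟩
    have h1 : Tendsto (fun n => |M (dyadicAbove n t) ω|) atTop (𝓝 |M t ω|) :=
      ((hrc ω t).tendsto.comp (tendsto_dyadicAbove t)).abs
    obtain ⟨N, hN⟩ := eventually_atTop.1
      ((h1.eventually (lt_mem_nhds ht)).and (eventually_ge_atTop ⌈t⌉₊))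
    refine mem_iUnion.2 ⟨N, mem_iInter₂.2 fun m hm => ?_⟩
    obtain ⟨h2, h3⟩ := hN m hm
    refine ⟨⌊t * 2 ^ m⌋₊ + 1, ?_, h2.le⟩
    have h4 : t ≤ m := Nat.ceil_le.1 h3
    have h5 : ⌊t * 2 ^ m⌋₊ ≤ m * 2 ^ m := by
      refine Nat.floor_le_of_le ?_
      push_cast
      gcongr
    omega
  calc P {ω | ∃ t, c < |M t ω|} ≤ P (⋃ n, U n) := measure_mono hsub
    _ = ⨆ n, P (U n) := hUmono.measure_iUnion
    _ ≤ _ := iSup_le fun n => (measure_mono (iInter₂_subset n le_rfl)).trans (hSle n)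

/-- A closed right-continuous martingale converges almost surely along the reals if it does so, and
in mean, along the integers: the weak type inequality for the increments after time `n` controls
the oscillation of the path. -/
lemma ae_tendsto_of_tendsto_nat [IsFiniteMeasure P] {ℱ : Filtration ℝ≥0 mΩ} {M : ℝ≥0 → Ω → ℝ}
    (hM : Martingale M ℱ P) (hrc : ∀ ω t, ContinuousWithinAt (fun t => M t ω) (Ici t) t)
    {g : Ω → ℝ} (hg : Integrable g P) (hcond : ∀ t, P[g | ℱ t] =ᵐ[P] M t)
    (hL1 : Tendsto (fun n : ℕ => ∫ ω, |g ω - M n ω| ∂P) atTop (𝓝 0))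
    (hae : ∀ᵐ ω ∂P, Tendsto (fun n : ℕ => M n ω) atTop (𝓝 (g ω))) :
    ∀ᵐ ω ∂P, Tendsto (fun t => M t ω) atTop (𝓝 (g ω)) := by
  have hosc : ∀ c : ℝ, 0 < c → ∀ n : ℕ, P {ω | ∃ t, c < |M (n + t) ω - M n ω|} ≤
      ENNReal.ofReal (2 / c * ∫ ω, |g ω - M n ω| ∂P) := by
    intro c hc n
    have hτ : Monotone (fun t : ℝ≥0 => (n : ℝ≥0) + t) := fun s t hst => by dsimp only; gcongr
    have hconst : Martingale (fun (_ : ℝ≥0) ω => M n ω) (sampledFiltration ℱ hτ) P := by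
      have hsm : ∀ t : ℝ≥0, StronglyMeasurable[ℱ (n + t)] (M n) := fun t =>
        (hM.1 n).mono (ℱ.mono (by simp))
      refine ⟨fun t => hsm t, fun s t _ => ?_⟩
      exact (condExp_of_stronglyMeasurable (ℱ.le _) (hsm s) (hM.integrable _)).eventuallyEq
    have hN := (martingale_sampled hM hτ).sub hconst
    refine measure_exists_lt_abs_le hN (fun ω t => ?_) hc fun t => ?_
    · refine ContinuousWithinAt.sub ?_ continuousWithinAt_const
      have h1 : ContinuousWithinAt (fun t : ℝ≥0 => (n : ℝ≥0) + t) (Ici t) t := by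
        have : Continuous (fun t : ℝ≥0 => (n : ℝ≥0) + t) := by fun_prop
        exact this.continuousWithinAt
      exact ContinuousWithinAt.comp (t := Ici ((n : ℝ≥0) + t)) (hrc ω (n + t)) h1
        (fun s hs => hτ hs)
    · have hi : Integrable (fun ω => |M (n + t) ω - M n ω|) P :=
        ((hM.integrable _).sub (hM.integrable _)).abs
      refine (setIntegral_le_integral hi (ae_of_all _ fun ω => abs_nonneg _)).trans ?_
      have hce : P[g - M n | ℱ (n + t)] =ᵐ[P] fun ω => M (n + t) ω - M n ω := by
        have h2 := condExp_of_stronglyMeasurable (ℱ.le _)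
          ((hM.1 n).mono (ℱ.mono (show (n : ℝ≥0) ≤ n + t by simp))) (hM.integrable n)
        filter_upwards [condExp_sub hg (hM.integrable n) (ℱ (n + t)), hcond (n + t)]
          with ω h3 h4
        rw [h3, Pi.sub_apply, h4, h2]
      calc ∫ ω, |M (n + t) ω - M n ω| ∂P = ∫ ω, |(P[g - M n | ℱ (n + t)]) ω| ∂P :=
            integral_congr_ae (by filter_upwards [hce] with ω hω; rw [hω])
        _ ≤ ∫ ω, |(g - M n) ω| ∂P := integral_abs_condExp_le _
  have hsmall : ∀ j : ℕ, ∀ᵐ ω ∂P, ∃ n : ℕ, ∀ t, |M (n + t) ω - M n ω| ≤ 1 / ((j : ℝ) + 1) := by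
    intro j
    have hj : (0 : ℝ) < 1 / ((j : ℝ) + 1) := by positivity
    rw [ae_iff]
    have hle : ∀ n : ℕ, P {ω | ¬∃ n : ℕ, ∀ t, |M (n + t) ω - M n ω| ≤ 1 / ((j : ℝ) + 1)} ≤
        ENNReal.ofReal (2 / (1 / ((j : ℝ) + 1)) * ∫ ω, |g ω - M n ω| ∂P) := fun n =>
      (measure_mono fun ω hω => by
        simp only [mem_ofPred_eq, not_exists, not_forall, not_le] at hω
        exact hω n).trans (hosc _ hj n)
    have h0 := ENNReal.tendsto_ofReal (hL1.const_mul (2 / (1 / ((j : ℝ) + 1))))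
    rw [mul_zero, ENNReal.ofReal_zero] at h0
    exact le_antisymm (ge_of_tendsto' h0 hle) zero_le
  filter_upwards [hae, ae_all_iff.2 hsmall] with ω h1 h2
  rw [Metric.tendsto_atTop]
  intro ε hε
  obtain ⟨j, hj⟩ := exists_nat_one_div_lt (half_pos hε)
  obtain ⟨n, hn⟩ := h2 j
  have hlim : |g ω - M n ω| ≤ 1 / ((j : ℝ) + 1) := by
    refine le_of_tendsto (h1.sub_const (M n ω)).abs ?_
    filter_upwards [eventually_ge_atTop n] with m hm
    have := hn ((m - n : ℕ) : ℝ≥0)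
    rwa [← Nat.cast_add, Nat.add_sub_cancel' hm] at this
  refine ⟨n, fun s hs => ?_⟩
  have h3 := hn (s - n)
  rw [add_tsub_cancel_of_le hs] at h3
  rw [Real.dist_eq]
  calc |M s ω - g ω| = |(M s ω - M n ω) - (g ω - M n ω)| := by ring_nf
    _ ≤ |M s ω - M n ω| + |g ω - M n ω| := abs_sub _ _
    _ < ε := by linarith

end Martingales

/-! ### Exponential averages of a path -/

section Paths

/-- An exponentially weighted average of a bounded convergent path converges, by dominated
convergence after the substitution `s = t - r`. -/
lemma tendsto_exp_weighted_average {a K L : ℝ} (ha : 0 < a) {v : ℝ → ℝ} (hv : Measurable v)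
    (hK : ∀ s, |v s| ≤ K) (hL : Tendsto v atTop (𝓝 L)) :
    Tendsto (fun t : ℝ => Real.exp (-a * t) * ∫ s in (0 : ℝ)..t, Real.exp (a * s) * v s) atTop
      (𝓝 (L / a)) := by
  have hlim : L / a = ∫ r in Ioi (0 : ℝ), Real.exp (-a * r) * L := by
    rw [integral_mul_const, integral_exp_mul_Ioi (by linarith)]
    simp
    ring
  rw [hlim]
  have hexp : IntegrableOn (fun r => Real.exp (-a * r)) (Ioi 0) := by
    exact integrableOn_exp_mul_Ioi (by linarith) 0
  have hEq : ∀ t : ℝ, 0 ≤ t →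
      ∫ r in Ioi (0 : ℝ), (Iic t).indicator (fun r => Real.exp (-a * r) * v (t - r)) r =
      Real.exp (-a * t) * ∫ s in (0 : ℝ)..t, Real.exp (a * s) * v s := by
    intro t ht
    have h1 := intervalIntegral.integral_comp_sub_left (a := 0) (b := t)
      (fun s => Real.exp (a * s) * v s) t
    rw [sub_self, sub_zero] at h1
    rw [← h1, ← intervalIntegral.integral_const_mul, intervalIntegral.integral_of_le ht,
      setIntegral_indicator measurableSet_Iic, Ioi_inter_Iic]
    refine integral_congr_ae (ae_of_all _ fun r => ?_)
    simp only
    rw [← mul_assoc, ← Real.exp_add]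
    ring_nf
  refine Tendsto.congr' (f₁ := fun t : ℝ => ∫ r in Ioi (0 : ℝ),
    (Iic t).indicator (fun r => Real.exp (-a * r) * v (t - r)) r) ?_ ?_
  · filter_upwards [eventually_ge_atTop 0] with t ht using hEq t ht
  refine tendsto_integral_filter_of_dominated_convergence (fun r => Real.exp (-a * r) * K)
    (Eventually.of_forall fun t => ?_) (Eventually.of_forall fun t => ae_of_all _ fun r => ?_)
    (hexp.mul_const K) (ae_of_all _ fun r => ?_)
  · refine (Measurable.indicator ?_ measurableSet_Iic).aestronglyMeasurable
    exact (by fun_prop : Measurable fun r => Real.exp (-a * r)).mul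
      (hv.comp (measurable_id.const_sub t))
  · refine (norm_indicator_le_norm_self _ _).trans ?_
    rw [norm_mul, Real.norm_eq_abs, Real.norm_eq_abs, Real.abs_exp]
    exact mul_le_mul_of_nonneg_left (hK _) (Real.exp_pos _).le
  · have h2 : Tendsto (fun t : ℝ => t - r) atTop atTop := tendsto_atTop_add_const_right _ _ tendsto_id
    refine ((hL.comp h2).const_mul (Real.exp (-a * r))).congr' ?_
    filter_upwards [eventually_ge_atTop r] with t ht
    rw [indicator_of_mem (show r ∈ Iic t from ht)]
    rfl

lemma exp_weighted_average_le {a K t : ℝ} (ha : 0 < a) (ht : 0 ≤ t) {v : ℝ → ℝ} (hv : Measurable v)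
    (hv0 : ∀ s, 0 ≤ v s) (hK : ∀ s, v s ≤ K) :
    Real.exp (-a * t) * ∫ s in (0 : ℝ)..t, Real.exp (a * s) * v s ≤ K / a := by
  have hK0 : 0 ≤ K := (hv0 0).trans (hK 0)
  have hi : IntervalIntegrable (fun s => Real.exp (a * s) * v s) volume 0 t := by
    refine (Continuous.intervalIntegrable (u := fun s => Real.exp (a * s) * K) (by fun_prop)
      0 t).mono_fun ?_ (ae_of_all _ fun s => ?_)
    · exact ((by fun_prop : Measurable fun s => Real.exp (a * s)).mul hv).aestronglyMeasurable
    · dsimp only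
      rw [norm_mul, norm_mul, Real.norm_of_nonneg (hv0 s), Real.norm_of_nonneg hK0]
      exact mul_le_mul_of_nonneg_left (hK s) (norm_nonneg _)
  have h1 : ∫ s in (0 : ℝ)..t, Real.exp (a * s) * v s ≤
      (Real.exp (a * t) - 1) / a * K := by
    calc _ ≤ ∫ s in (0 : ℝ)..t, Real.exp (a * s) * K :=
          intervalIntegral.integral_mono_on ht hi (Continuous.intervalIntegrable (by fun_prop) _ _)
            fun s _ => mul_le_mul_of_nonneg_left (hK s) (Real.exp_pos _).le
      _ = _ := by
          rw [intervalIntegral.integral_mul_const, integral_exp_const_mul ha.ne', mul_zero,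
            Real.exp_zero]
  calc _ ≤ Real.exp (-a * t) * ((Real.exp (a * t) - 1) / a * K) :=
        mul_le_mul_of_nonneg_left h1 (Real.exp_pos _).le
    _ = (Real.exp (-a * t + a * t) - Real.exp (-a * t)) / a * K := by rw [Real.exp_add]; ring
    _ = (1 - Real.exp (-a * t)) / a * K := by
        rw [show -a * t + a * t = 0 by ring, Real.exp_zero]
    _ ≤ 1 / a * K := by
        gcongr
        linarith [Real.exp_pos (-a * t)]
    _ = K / a := by ring

end Paths

/-! ### The supremum and the terminal value of `W` -/

section Supremum

variable {Ω : Type*} {mΩ : MeasurableSpace Ω} {b : ℝ} {ℱ : Filtration ℝ≥0 mΩ}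
    {P : Measure Ω} {Z : ℝ≥0 → Ω → ℝ}

/-- The tail of the supremum of `W` decays faster than every power. -/
lemma IsProcess.exists_measure_lt_W_le [IsProbabilityMeasure P] (hZ : IsProcess b ℱ P Z)
    (hb0 : 0 ≤ b) (hb1 : b < 1) (m : ℕ) : ∃ C : ℝ, 0 ≤ C ∧ ∀ c : ℝ, 0 < c →
      P {ω | ∃ t, c < W b Z t ω} ≤ ENNReal.ofReal (C / c ^ (m + 1)) := by
  obtain ⟨C, hC0, hC⟩ := hZ.exists_moment_W_le hb0 hb1 (m + 1)
  refine ⟨2 ^ (m + 1) * C, by positivity, fun c hc => ?_⟩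
  have habs : ∀ t ω, |W b Z t ω| = W b Z t ω := fun t ω => abs_of_pos (hZ.W_pos t ω)
  have h := measure_exists_lt_abs_le (hZ.martingale_W hb0 hb1) hZ.right_cont_W hc
    (K := (2 / c) ^ m * C) (fun t => by
      simp_rw [habs]
      obtain ⟨h1, h2⟩ := hC t
      have hms : MeasurableSet {ω | c / 2 ≤ W b Z t ω} :=
        measurableSet_le measurable_const (hZ.measurable_W t)
      calc ∫ ω in {ω | c / 2 ≤ W b Z t ω}, W b Z t ω ∂P
          ≤ ∫ ω in {ω | c / 2 ≤ W b Z t ω}, (2 / c) ^ m * W b Z t ω ^ (m + 1) ∂P := by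
            refine setIntegral_mono_on ((hZ.martingale_W hb0 hb1).integrable t).integrableOn
              (h1.const_mul _).integrableOn hms fun ω hω => ?_
            have h3 : 1 ≤ 2 / c * W b Z t ω := by
              rw [div_mul_eq_mul_div, le_div_iff₀ hc]
              have : c / 2 ≤ W b Z t ω := hω
              linarith
            calc W b Z t ω ≤ (2 / c * W b Z t ω) ^ m * W b Z t ω :=
                  le_mul_of_one_le_left (hZ.W_pos t ω).le (one_le_pow₀ h3)
              _ = _ := by rw [mul_pow]; ring
        _ ≤ ∫ ω, (2 / c) ^ m * W b Z t ω ^ (m + 1) ∂P :=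
            setIntegral_le_integral (h1.const_mul _) (ae_of_all _ fun ω =>
              mul_nonneg (by positivity) (pow_nonneg (hZ.W_pos t ω).le _))
        _ ≤ _ := by
            rw [integral_const_mul]
            exact mul_le_mul_of_nonneg_left h2 (by positivity))
  simp_rw [habs] at h
  refine h.trans_eq ?_
  congr 1
  rw [div_pow]
  field_simp
  ring

lemma IsProcess.ae_bddAbove_W [IsProbabilityMeasure P] (hZ : IsProcess b ℱ P Z)
    (hb0 : 0 ≤ b) (hb1 : b < 1) : ∀ᵐ ω ∂P, BddAbove (range fun t : ℝ≥0 => W b Z t ω) := by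
  obtain ⟨C, -, hC⟩ := hZ.exists_measure_lt_W_le hb0 hb1 0
  rw [ae_iff]
  have hle : ∀ n : ℕ, P {ω | ¬BddAbove (range fun t : ℝ≥0 => W b Z t ω)} ≤
      ENNReal.ofReal (C * (1 / ((n : ℝ) + 1))) := by
    intro n
    refine (measure_mono fun ω hω => ?_).trans
      ((hC ((n : ℝ) + 1) (by positivity)).trans_eq (by rw [zero_add, pow_one, mul_one_div]))
    obtain ⟨y, ⟨t, rfl⟩, hy⟩ := not_bddAbove_iff.1 hω ((n : ℝ) + 1)
    exact ⟨t, hy⟩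
  have h0 := ENNReal.tendsto_ofReal
    ((tendsto_one_div_add_atTop_nhds_zero_nat (𝕜 := ℝ)).const_mul C)
  rw [mul_zero, ENNReal.ofReal_zero] at h0
  exact le_antisymm (ge_of_tendsto' h0 hle) zero_le

/-- By right-continuity the supremum may be taken over the dyadic times; this also covers the
unbounded paths, where both suprema take the default value. -/
lemma IsProcess.Wstar_eq_iSup_dyadic (hZ : IsProcess b ℱ P Z) (ω : Ω) :
    Wstar b Z ω = ⨆ p : ℕ × ℕ, W b Z ((p.1 : ℕ) / 2 ^ p.2) ω := by
  have hub : upperBounds (range fun t : ℝ≥0 => W b Z t ω) =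
      upperBounds (range fun p : ℕ × ℕ => W b Z ((p.1 : ℕ) / 2 ^ p.2) ω) := by
    refine Subset.antisymm (upperBounds_mono_set ?_) fun y hy => ?_
    · rintro _ ⟨p, rfl⟩
      exact ⟨_, rfl⟩
    · rintro _ ⟨t, rfl⟩
      refine le_of_tendsto' ((hZ.right_cont_W ω t).tendsto.comp (tendsto_dyadicAbove t)) fun n => ?_
      exact hy ⟨(⌊t * 2 ^ n⌋₊ + 1, n), rfl⟩
  rw [Wstar, iSup, iSup]
  by_cases hb : BddAbove (range fun t : ℝ≥0 => W b Z t ω)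
  · have h1 := isLUB_csSup (range_nonempty _) hb
    have hb' : BddAbove (range fun p : ℕ × ℕ => W b Z ((p.1 : ℕ) / 2 ^ p.2) ω) := by
      rw [BddAbove, ← hub]; exact hb
    have h2 := isLUB_csSup (range_nonempty _) hb'
    rw [IsLUB, ← hub] at h2
    exact h1.unique h2
  · have hb' : ¬BddAbove (range fun p : ℕ × ℕ => W b Z ((p.1 : ℕ) / 2 ^ p.2) ω) := by
      rw [BddAbove, ← hub]; exact hb
    rw [Real.sSup_of_not_bddAbove hb, Real.sSup_of_not_bddAbove hb']

lemma IsProcess.measurable_Wstar (hZ : IsProcess b ℱ P Z) : Measurable (Wstar b Z) := by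
  have : Wstar b Z = fun ω => ⨆ p : ℕ × ℕ, W b Z ((p.1 : ℕ) / 2 ^ p.2) ω :=
    funext hZ.Wstar_eq_iSup_dyadic
  rw [this]
  exact Measurable.iSup fun p => hZ.measurable_W _

lemma IsProcess.Wstar_nonneg (hZ : IsProcess b ℱ P Z) (ω : Ω) : 0 ≤ Wstar b Z ω :=
  Real.iSup_nonneg fun t => (hZ.W_pos t ω).le

/-- The tail bound of order `m + 2` and the layer cake formula give a finite moment of order
`m + 1`. -/
lemma IsProcess.lintegral_Wstar_lt_top [IsProbabilityMeasure P] (hZ : IsProcess b ℱ P Z)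
    (hb0 : 0 ≤ b) (hb1 : b < 1) (m : ℕ) :
    ∫⁻ ω, ENNReal.ofReal (Wstar b Z ω ^ ((m : ℝ) + 1)) ∂P < ∞ := by
  obtain ⟨C, hC0, hC⟩ := hZ.exists_measure_lt_W_le hb0 hb1 (m + 1)
  rw [lintegral_rpow_eq_lintegral_meas_lt_mul P (ae_of_all _ hZ.Wstar_nonneg)
    hZ.measurable_Wstar.aemeasurable (by positivity)]
  refine ENNReal.mul_lt_top ENNReal.ofReal_lt_top ?_
  rw [← Ioc_union_Ioi_eq_Ioi (zero_le_one' ℝ)]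
  refine (lintegral_union_le _ _ _).trans_lt (ENNReal.add_lt_top.2 ⟨?_, ?_⟩)
  · calc ∫⁻ t in Ioc (0 : ℝ) 1, P {ω | t < Wstar b Z ω} * ENNReal.ofReal (t ^ ((m : ℝ) + 1 - 1))
        ≤ ∫⁻ t in Ioc (0 : ℝ) 1, 1 := by
          refine setLIntegral_mono measurable_const fun t ht => ?_
          refine mul_le_one' prob_le_one ?_
          rw [ENNReal.ofReal_le_one]
          exact Real.rpow_le_one ht.1.le ht.2 (by simp)
      _ < ∞ := by simp
  · calc ∫⁻ t in Ioi (1 : ℝ), P {ω | t < Wstar b Z ω} * ENNReal.ofReal (t ^ ((m : ℝ) + 1 - 1))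
        ≤ ∫⁻ t in Ioi (1 : ℝ), ENNReal.ofReal (C * t ^ (-2 : ℝ)) := by
          refine setLIntegral_mono (by fun_prop) fun t ht => ?_
          have ht0 : (0 : ℝ) < t := lt_trans zero_lt_one ht
          have hP : P {ω | t < Wstar b Z ω} ≤ ENNReal.ofReal (C / t ^ (m + 1 + 1)) :=
            (measure_mono fun ω hω => exists_lt_of_lt_ciSup hω).trans (hC t ht0)
          refine (mul_le_mul_left hP _).trans_eq ?_
          rw [← ENNReal.ofReal_mul (by positivity)]
          congr 1
          rw [add_sub_cancel_right, Real.rpow_natCast, Real.rpow_neg ht0.le]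
          norm_cast
          field_simp
          ring
      _ < ∞ := by
          have hi : IntegrableOn (fun t : ℝ => C * t ^ (-2 : ℝ)) (Ioi 1) :=
            (integrableOn_Ioi_rpow_of_lt (by norm_num) zero_lt_one).const_mul C
          exact hi.lintegral_lt_top

lemma IsProcess.memLp_Wstar [IsProbabilityMeasure P] (hZ : IsProcess b ℱ P Z)
    (hb0 : 0 ≤ b) (hb1 : b < 1) (k : ℝ≥0) : MemLp (Wstar b Z) k P := by
  set m : ℕ := ⌈k⌉₊ with hm
  have hkm : (k : ℝ≥0∞) ≤ ((m + 1 : ℕ) : ℝ≥0∞) := by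
    have : k ≤ ((m + 1 : ℕ) : ℝ≥0) := (Nat.le_ceil k).trans (by simp [hm])
    exact_mod_cast this
  refine MemLp.mono_exponent ⟨hZ.measurable_Wstar.aestronglyMeasurable, ?_⟩ hkm
  rw [eLpNorm_lt_top_iff_lintegral_rpow_enorm_lt_top (by simp) (by simp)]
  refine lt_of_le_of_lt (le_of_eq (lintegral_congr fun ω => ?_))
    (hZ.lintegral_Wstar_lt_top hb0 hb1 m)
  rw [ENNReal.toReal_natCast, Real.enorm_of_nonneg (hZ.Wstar_nonneg ω),
    ENNReal.ofReal_rpow_of_nonneg (hZ.Wstar_nonneg ω) (by positivity)]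
  push_cast
  rfl

/-- The terminal value of `W`: the limit along the integers, which closes the martingale by
domination by `Wstar`, and is then the limit along the reals. -/
lemma IsProcess.exists_terminal_value [IsProbabilityMeasure P] (hZ : IsProcess b ℱ P Z)
    (hb0 : 0 ≤ b) (hb1 : b < 1) : ∃ g : Ω → ℝ, Integrable g P ∧
      (∀ᵐ ω ∂P, Tendsto (fun t : ℝ≥0 => W b Z t ω) atTop (𝓝 (g ω))) ∧
      ∀ t : ℝ≥0, P[g | ℱ t] =ᵐ[P] W b Z t := by
  have hM := hZ.martingale_W hb0 hb1
  have hstar : Integrable (Wstar b Z) P := by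
    have := hZ.memLp_Wstar hb0 hb1 1
    rw [ENNReal.coe_one] at this
    exact memLp_one_iff_integrable.1 this
  obtain ⟨C, hC⟩ := hZ.exists_eLpNorm_W_le hb0 hb1 1
  have hτ : Monotone (fun n : ℕ => (n : ℝ≥0)) := Nat.mono_cast
  have hMn := (martingale_sampled hM hτ).submartingale
  have hbdd : ∀ n : ℕ, eLpNorm (W b Z n) 1 P ≤ C := fun n => by simpa using hC n
  obtain ⟨g, hae, hg⟩ : ∃ g : Ω → ℝ,
      (∀ᵐ ω ∂P, Tendsto (fun n : ℕ => W b Z n ω) atTop (𝓝 (g ω))) ∧ Integrable g P :=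
    ⟨_, hMn.ae_tendsto_limitProcess hbdd,
      memLp_one_iff_integrable.1 (hMn.memLp_limitProcess hbdd)⟩
  have hWle : ∀ᵐ ω ∂P, ∀ t : ℝ≥0, W b Z t ω ≤ Wstar b Z ω := by
    filter_upwards [hZ.ae_bddAbove_W hb0 hb1] with ω hω t
    exact le_ciSup hω t
  have hset : ∀ A : Set Ω,
      Tendsto (fun n : ℕ => ∫ ω in A, W b Z n ω ∂P) atTop (𝓝 (∫ ω in A, g ω ∂P)) := fun A =>
    tendsto_integral_of_dominated_convergence (Wstar b Z)
      (fun n => (hZ.measurable_W n).aestronglyMeasurable) hstar.integrableOn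
      (fun n => ae_restrict_of_ae (by
        filter_upwards [hWle] with ω hω
        rw [Real.norm_of_nonneg (hZ.W_pos n ω).le]
        exact hω n))
      (ae_restrict_of_ae hae)
  have hcond : ∀ t : ℝ≥0, P[g | ℱ t] =ᵐ[P] W b Z t := by
    intro t
    refine (ae_eq_condExp_of_forall_setIntegral_eq (ℱ.le t) hg
      (fun A _ _ => (hM.integrable t).integrableOn) (fun A hA _ => ?_)
      (hM.1 t).aestronglyMeasurable).symm
    refine tendsto_nhds_unique (tendsto_const_nhds.congr' ?_) (hset A)
    filter_upwards [eventually_ge_atTop ⌈t⌉₊] with n hn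
    exact hM.setIntegral_eq (Nat.ceil_le.1 hn) hA
  have hL1 : Tendsto (fun n : ℕ => ∫ ω, |g ω - W b Z n ω| ∂P) atTop (𝓝 0) := by
    have h := tendsto_integral_of_dominated_convergence (μ := P)
      (F := fun (n : ℕ) ω => |g ω - W b Z n ω|) (f := fun _ => 0)
      (fun ω => |g ω| + Wstar b Z ω)
      (fun n => (hg.sub (hM.integrable n)).abs.aestronglyMeasurable) (hg.abs.add hstar)
      (fun n => by
        filter_upwards [hWle] with ω hω
        rw [Real.norm_eq_abs, abs_abs]
        refine (abs_sub _ _).trans (add_le_add_right ?_ _)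
        rw [abs_of_pos (hZ.W_pos n ω)]
        exact hω n)
      (by
        filter_upwards [hae] with ω hω
        simpa using (hω.const_sub (g ω)).abs)
    simpa using h
  exact ⟨g, hg, ae_tendsto_of_tendsto_nat hM hZ.right_cont_W hg hcond hL1 hae, hcond⟩

lemma exp_mul_B_eq (b : ℝ) (Z : ℝ≥0 → Ω → ℝ) (t : ℝ≥0) (ω : Ω) :
    Real.exp (-(1 - b) * t) * B b Z t ω = W b Z t ω + b * (Real.exp (-(1 - b) * t) *
      ∫ s in (0 : ℝ)..t, Real.exp ((1 - b) * s) * W b Z s.toNNReal ω) := by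
  have h : ∫ s in (0 : ℝ)..t, Real.exp ((1 - b) * s) * W b Z s.toNNReal ω =
      ∫ s in (0 : ℝ)..t, Z s.toNNReal ω := by
    refine intervalIntegral.integral_congr fun s hs => ?_
    rw [uIcc_of_le t.coe_nonneg] at hs
    simp only [W]
    rw [Real.coe_toNNReal s hs.1, ← mul_assoc, ← Real.exp_add,
      show (1 - b) * s + -(1 - b) * s = 0 by ring, Real.exp_zero, one_mul]
  rw [h, B, W]
  ring

lemma IsProcess.measurable_path_W (hZ : IsProcess b ℱ P Z) (ω : Ω) :
    Measurable (fun s : ℝ => W b Z s.toNNReal ω) :=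
  (measurable_uncurry_of_right_cont hZ.measurable_W hZ.right_cont_W).comp
    (measurable_id.prodMk measurable_const)

lemma IsProcess.exp_mul_B_le (hZ : IsProcess b ℱ P Z) (hb0 : 0 ≤ b) (hb1 : b < 1) {ω : Ω}
    (hω : BddAbove (range fun t : ℝ≥0 => W b Z t ω)) (t : ℝ≥0) :
    Real.exp (-(1 - b) * t) * B b Z t ω ≤ 1 / (1 - b) * Wstar b Z ω := by
  have ha : 0 < 1 - b := by linarith
  have hle : ∀ t, W b Z t ω ≤ Wstar b Z ω := le_ciSup hω
  rw [exp_mul_B_eq]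
  have h := exp_weighted_average_le ha t.coe_nonneg (hZ.measurable_path_W ω)
    (fun s => (hZ.W_pos _ ω).le) (fun s => hle _)
  calc _ ≤ Wstar b Z ω + b * (Wstar b Z ω / (1 - b)) :=
        add_le_add (hle t) (mul_le_mul_of_nonneg_left h hb0)
    _ = _ := by field_simp; ring

lemma IsProcess.tendsto_exp_mul_B (hZ : IsProcess b ℱ P Z) (hb1 : b < 1) {ω : Ω} {L : ℝ}
    (hω : BddAbove (range fun t : ℝ≥0 => W b Z t ω))
    (hL : Tendsto (fun t : ℝ≥0 => W b Z t ω) atTop (𝓝 L)) :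
    Tendsto (fun t : ℝ≥0 => Real.exp (-(1 - b) * t) * B b Z t ω) atTop (𝓝 (1 / (1 - b) * L)) := by
  have ha : 0 < 1 - b := by linarith
  simp_rw [exp_mul_B_eq]
  have h := tendsto_exp_weighted_average ha (hZ.measurable_path_W ω) (K := Wstar b Z ω)
    (fun s => by rw [abs_of_pos (hZ.W_pos _ ω)]; exact le_ciSup hω _)
    (hL.comp Real.tendsto_toNNReal_atTop)
  have h' := hL.add ((h.comp (NNReal.tendsto_coe_atTop.2 tendsto_id)).const_mul b)
  have e : L + b * (L / (1 - b)) = 1 / (1 - b) * L := by field_simp; ring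
  rw [e] at h'
  exact h'

end Supremum

end CSBP

theorem corollary3 {Ω : Type*} {mΩ : MeasurableSpace Ω} (P : Measure Ω) [IsProbabilityMeasure P]
    (ℱ : Filtration ℝ≥0 mΩ) (b : ℝ) (hb0 : 0 ≤ b) (hb1 : b < 1)
    (Z : ℝ≥0 → Ω → ℝ) (hZ : CSBP.IsProcess b ℱ P Z) :
    -- `W` is a martingale, bounded in every `L^k`
    Martingale (CSBP.W b Z) ℱ P ∧
    (∀ k : ℝ≥0, 1 ≤ k → ∃ C : ℝ≥0, ∀ t : ℝ≥0, eLpNorm (CSBP.W b Z t) k P ≤ C) ∧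
    -- the terminal value of `W`, and the almost sure limit of the rescaled `B`
    (∃ Winf : Ω → ℝ, Integrable Winf P ∧
      (∀ᵐ ω ∂P, Tendsto (fun t : ℝ≥0 => CSBP.W b Z t ω) atTop (𝓝 (Winf ω))) ∧
      (∀ t : ℝ≥0, P[Winf | ℱ t] =ᵐ[P] CSBP.W b Z t) ∧
      (∀ᵐ ω ∂P, Tendsto (fun t : ℝ≥0 => Real.exp (-(1 - b) * t) * CSBP.B b Z t ω) atTop
        (𝓝 (1 / (1 - b) * Winf ω)))) ∧
    -- `W*` is almost surely finite and dominates the rescaled `B`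
    (∀ᵐ ω ∂P, BddAbove (range fun t : ℝ≥0 => CSBP.W b Z t ω) ∧
      BddAbove (range fun t : ℝ≥0 => Real.exp (-(1 - b) * t) * CSBP.B b Z t ω) ∧
      (⨆ t : ℝ≥0, Real.exp (-(1 - b) * t) * CSBP.B b Z t ω) ≤ 1 / (1 - b) * CSBP.Wstar b Z ω) ∧
    -- the dominating variable lies in every `L^k`
    (∀ k : ℝ≥0, 1 ≤ k → MemLp (fun ω => 1 / (1 - b) * CSBP.Wstar b Z ω) k P) := by
  have hbdd := hZ.ae_bddAbove_W hb0 hb1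
  refine ⟨hZ.martingale_W hb0 hb1, fun k _ => hZ.exists_eLpNorm_W_le hb0 hb1 k, ?_, ?_,
    fun k _ => (hZ.memLp_Wstar hb0 hb1 k).const_mul _⟩
  · obtain ⟨g, hg, hlim, hcond⟩ := hZ.exists_terminal_value hb0 hb1
    refine ⟨g, hg, hlim, hcond, ?_⟩
    filter_upwards [hbdd, hlim] with ω h1 h2
    exact hZ.tendsto_exp_mul_B hb1 h1 h2
  · filter_upwards [hbdd] with ω hω
    have hle := hZ.exp_mul_B_le hb0 hb1 hω
    refine ⟨hω, ⟨1 / (1 - b) * CSBP.Wstar b Z ω, ?_⟩, ciSup_le hle⟩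
    rintro _ ⟨t, rfl⟩
    exact hle t
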